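/- A disjunctive program $\Pi$ is a finite set of rules $a_1\vee\dots\vee a_\ell\leftarrow a_{\ell+1},\dots,a_m,\neg a_{m+1},\dots,\neg a_n$ with pairwise distinct propositional atoms $a_1,\dots,a_n$; $\mathrm{at}(\Pi)$ is its set of atoms, and $\Pi$ is \emph{normalized} if every rule contains at most three atoms. $\Pi$ is \emph{consistent} if it has an answer set, i.e. an interpretation $I$ that is a $\subseteq$-minimal model of the Gelfond--Lifschitz reduct $\Pi^I$. The \emph{primal graph} $\mathcal G_\Pi$ has vertex set $\mathrm{at}(\Pi)$ and an edge between any two distinct atoms that occur together in a rule; the \emph{incidence graph} $\mathcal I_\Pi$ has the atoms and the rules of $\Pi$ as vertices and an edge between an atom and a rule whenever the atom occurs in the rule. The \emph{bandwidth} of a finite graph $(V,E)$ is the minimum over all bijections $f\colon V\to\{1,\dots,|V|\}$ of $\max_{\{u,v\}\in E}|f(u)-f(v)|$ (which is $0$ if $E=\emptyset$). The Exponential Time Hypothesis (ETH) states that there is a $\delta>0$ such that no (deterministic) algorithm decides satisfiability of 3-CNF formulas with $n$ variables in time $2^{\delta n}\cdot\mathrm{poly}(n)$. \textbf{Theorem.}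 Assume ETH. Then there is no algorithm that decides the consistency of normalized disjunctive programs $\Pi$ in time $2^{2^{o(k)}}\cdot\mathrm{poly}(|\mathrm{at}(\Pi)|)$, where $k$ is the bandwidth of $\mathcal G_\Pi$. Likewise, there is no algorithm that decides it in time $2^{2^{o(k)}}\cdot\mathrm{poly}(|\mathrm{at}(\Pi)|)$, where $k$ is the bandwidth of $\mathcal I_\Pi$. Here algorithms are multi-stack (equivalently, multi-tape) Turing machines. Programs and formulas are given without repetition of rules or clauses, with atoms (variables) named $0,1,\dots,|\mathrm{at}(\Pi)|-1$ (respectively $0,\dots,n-1$), so that input lengths are polynomial in $|\mathrm{at}(\Pi)|$ (respectively $n$). -/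

import Mathlib

namespace DisjASP

/-! ### Disjunctive logic programs -/

/-- A rule `a₁ ∨ … ∨ a_ℓ ← a_{ℓ+1}, …, a_m, ¬a_{m+1}, …, ¬a_n` over pairwise distinct atoms:
`head = {a₁, …, a_ℓ}`, `pos = {a_{ℓ+1}, …, a_m}`, `neg = {a_{m+1}, …, a_n}`. -/
@[ext]
structure Rule (α : Type*) where
  head : Finset α
  pos : Finset α
  neg : Finset α
  disjoint_head_pos : Disjoint head pos
  disjoint_head_neg : Disjoint head neg
  disjoint_pos_neg : Disjoint pos neg

/-- A (finite, disjunctive) program is a finite set of rules. -/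
abbrev Program (α : Type*) := Finset (Rule α)

variable {α : Type*}

/-- The rule with its negative body removed. -/
def Rule.dropNeg (r : Rule α) : Rule α where
  head := r.head
  pos := r.pos
  neg := ∅
  disjoint_head_pos := r.disjoint_head_pos
  disjoint_head_neg := Finset.disjoint_empty_right _
  disjoint_pos_neg := Finset.disjoint_empty_right _

/-- The atoms of a rule. -/
def Rule.atoms [DecidableEq α] (r : Rule α) : Finset α := r.head ∪ r.pos ∪ r.neg

/-- The atoms `at(P)` of a program. -/
def Program.atoms [DecidableEq α] (P : Program α) : Finset α := P.biUnion Rule.atoms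

/-- Normalized: every rule has at most three atoms. -/
def Program.IsNormalized [DecidableEq α] (P : Program α) : Prop := ∀ r ∈ P, r.atoms.card ≤ 3

/-- The interpretation `I` satisfies the rule `r`. -/
def Rule.Satisfies (I : Set α) (r : Rule α) : Prop :=
  (∃ a, (a ∈ r.head ∨ a ∈ r.neg) ∧ a ∈ I) ∨ ∃ a ∈ r.pos, a ∉ I

/-- `I` is a model of the set `R` of rules. -/
def IsModel (R : Set (Rule α)) (I : Set α) : Prop := ∀ r ∈ R, r.Satisfies I

/-- The Gelfond-Lifschitz reduct of `P` under `I`. -/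
def Program.reduct (P : Program α) (I : Set α) : Set (Rule α) :=
  {r | ∃ s ∈ P, (∀ a ∈ s.neg, a ∉ I) ∧ r = s.dropNeg}

/-- `I` is an answer set of `P`: a subset-minimal model of the reduct of `P` under `I`. -/
def Program.IsAnswerSet (P : Program α) (I : Set α) : Prop := Minimal (IsModel (P.reduct I)) I

/-- `P` has an answer set. -/
def Program.IsConsistent (P : Program α) : Prop := ∃ I : Set α, P.IsAnswerSet I

/-! ### Graph representations and bandwidth -/

/-- The primal graph: the vertices are the atoms of `P`; two distinct atoms are adjacent iff some
rule contains both. -/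
def Program.primalGraph [DecidableEq α] (P : Program α) : SimpleGraph {a // a ∈ P.atoms} where
  Adj a b := a ≠ b ∧ ∃ r ∈ P, a.1 ∈ r.atoms ∧ b.1 ∈ r.atoms
  symm := ⟨fun _ _ h => ⟨h.1.symm, h.2.imp fun _ hr => ⟨hr.1, hr.2.2, hr.2.1⟩⟩⟩
  loopless := ⟨fun _ h => h.1 rfl⟩

/-- The incidence graph: the vertices are the atoms and the rules of `P`; an atom is adjacent to
exactly those rules that contain it. -/
def Program.incidenceGraph [DecidableEq α] (P : Program α) :
    SimpleGraph ({a // a ∈ P.atoms} ⊕ {r // r ∈ P}) where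
  Adj
    | .inl a, .inr r => a.1 ∈ r.1.atoms
    | .inr r, .inl a => a.1 ∈ r.1.atoms
    | _, _ => False
  symm := ⟨by rintro (a | r) (b | s) h <;> exact h⟩
  loopless := ⟨by rintro (a | r) h <;> exact h⟩

/-- The bandwidth of a finite graph: the least `b` such that some bijective ordering
`f : V ≃ {0, …, |V| - 1}` has `|f u - f v| ≤ b` for every edge `uv`. (It is `0` if there are no
edges.) -/
noncomputable def bandwidth {V : Type*} (G : SimpleGraph V) : ℕ :=
  sInf {b : ℕ | ∃ f : V ≃ Fin (Nat.card V), ∀ u v, G.Adj u v →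
    |((f u : ℕ) : ℤ) - ((f v : ℕ) : ℤ)| ≤ (b : ℤ)}

/-! ### Propositional formulas in conjunctive normal form -/

/-- A clause: the variables that occur positively and those that occur negatively. -/
@[ext]
structure Clause where
  pos : Finset ℕ
  neg : Finset ℕ

/-- A formula in conjunctive normal form is a finite set of clauses. -/
abbrev CNF := Finset Clause

/-- The variables of a formula. -/
def CNF.vars (F : CNF) : Finset ℕ := F.biUnion fun C => C.pos ∪ C.neg

/-- Every clause has at most three literals. -/
def CNF.IsThreeCNF (F : CNF) : Prop := ∀ C ∈ F, C.pos.card + C.neg.card ≤ 3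

/-- Satisfiability. -/
def CNF.IsSatisfiable (F : CNF) : Prop :=
  ∃ σ : ℕ → Bool, ∀ C ∈ F, (∃ x ∈ C.pos, σ x = true) ∨ ∃ x ∈ C.neg, σ x = false

/-! ### Inputs as words over a finite alphabet -/

/-- The input alphabet. -/
inductive Symbol
  | tick
  | head
  | pos
  | neg
  | sep

/-- A finite set of atoms (or variables), all marked by `tag`: each `a` is written as `a` ticks
followed by `tag`. -/
def encodeMarked (tag : Symbol) (s : Finset ℕ) : List Symbol :=
  (s.sort (· ≤ ·)).flatMap fun a => List.replicate a Symbol.tick ++ [tag]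

def encodeRule (r : Rule ℕ) : List Symbol :=
  encodeMarked .head r.head ++ encodeMarked .pos r.pos ++ encodeMarked .neg r.neg ++ [.sep]

def encodeClause (C : Clause) : List Symbol :=
  encodeMarked .pos C.pos ++ encodeMarked .neg C.neg ++ [.sep]

/-- `l` lists the elements of `s` in some order, each of them once. -/
def Lists {β : Type*} (l : List β) (s : Finset β) : Prop := l.Nodup ∧ ∀ x, x ∈ l ↔ x ∈ s

/-! ### Machines with a step count -/

/-- Started on the word `w`, the multi-stack Turing machine `M` halts after at most `T` steps,
with output `true` if `A` holds and with output `false` otherwise. -/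
def DecidesWithin (M : Turing.TM2ComputableAux Symbol Bool) (w : List Symbol) (A : Prop)
    (T : ℝ) : Prop :=
  ∃ (b : Bool) (m : ℕ), (b = true ↔ A) ∧ (m : ℝ) ≤ T ∧
    Nonempty (Turing.TM2OutputsInTime M.tm (w.map M.inputAlphabet.symm)
      (some ((Computability.encodeBool b).map M.outputAlphabet.symm)) m)

/-- The Exponential Time Hypothesis: for some `δ > 0`, no machine decides the satisfiability of
3-CNF formulas with `n` variables in time `2^(δ n) · poly(n)`. The variables are named
`0, …, n - 1`, and a formula is given by a list of its clauses without repetitions, so the length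
of the input is polynomial in `n`. -/
def ExponentialTimeHypothesis : Prop :=
  ∃ δ : ℝ, 0 < δ ∧
    ¬ ∃ (M : Turing.TM2ComputableAux Symbol Bool) (p : Polynomial ℕ),
      ∀ (F : CNF) (l : List Clause) (n : ℕ), F.IsThreeCNF → F.vars = Finset.range n → Lists l F →
        DecidesWithin M (l.flatMap encodeClause) F.IsSatisfiable
          ((2 : ℝ) ^ (δ * (n : ℝ)) * ((p.eval n : ℕ) : ℝ))

/-- Some machine decides the consistency of normalized disjunctive programs `P` in time
`2^(2^o(k)) · poly(|at(P)|)`, where `k = κ P`. The atoms are named `0, …, |at(P)| - 1`, and a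
program is given by a list of its rules without repetitions, so the length of the input is
polynomial in `|at(P)|`. -/
def ConsistencyDecidableInTime (κ : Program ℕ → ℕ) : Prop :=
  ∃ (M : Turing.TM2ComputableAux Symbol Bool) (f : ℕ → ℝ) (p : Polynomial ℕ),
    Asymptotics.IsLittleO Filter.atTop f (fun k : ℕ => (k : ℝ)) ∧
    ∀ (P : Program ℕ) (l : List (Rule ℕ)), P.IsNormalized →
      P.atoms = Finset.range P.atoms.card → Lists l P →
        DecidesWithin M (l.flatMap encodeRule) P.IsConsistent
          ((2 : ℝ) ^ ((2 : ℝ) ^ f (κ P)) * ((p.eval P.atoms.card : ℕ) : ℝ))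

end DisjASP

/-! A 3-CNF formula whose input word has length `m` is turned in polynomial time into a normalized
program of bandwidth `O(log m)`. Since `m` is polynomial in the number `n` of variables, a running
time `2^(2^o(k))` with `k = O(log n)` is `2^(n^o(1))`, which is below `2^(δ n)` for every `δ > 0`
and contradicts ETH.

The formula is read as a sequence of tokens: literals and ends of clauses. With `L` bits per
variable, the program is a chain of blocks of nine atoms, with `L + 1` blocks for each token. A rule
touches only its own block, the preceding one and the one `L + 1` blocks earlier, so writing the
blocks in a row bounds the bandwidth of both graphs by a multiple of `L + 2`
(`Layout.atoms_bounds`).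

Small bandwidth leaves no room to remember an assignment. Instead, every literal occurrence guesses
the value of its variable anew, and a flag carried along the chain checks each clause. That all
occurrences of a variable agree is enforced by saturation. An answer set must contain the saturation
atom, and then all index bits are true in it. A smaller model of the reduct with the same guesses
may choose the bits of one index, which are copied from period to period and compared with each
token. It must saturate if all occurrences of the indexed variable have the same guess, and it can
avoid saturation if two guesses differ. Hence minimality says exactly that the guesses come from an
assignment. The two directions are `isConsistent_of_noneFalsified`, where every smaller model is
driven back to saturation, and `noneFalsified_of_isConsistent`, where `tokenModel_index` supplies
the smaller model for a variable with contradictory guesses.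

The reduction is carried out by an explicit stack machine. It is written in a small structured
language with a step-counting semantics (`Cmd.stepsTo_code`) and is composed with the assumed
decision machine in `precomp_outputs`. The growth estimate is `exists_two_pow_two_pow_le`. -/

namespace DisjASP
open Turing

/-! ### A structured language for multi-stack machines -/

/-- Structured programs over stacks indexed by `K` with the alphabet `A`. -/
inductive Cmd (K A : Type) where
  | skip : Cmd K A
  | push (k : K) (x : A) : Cmd K A
  | seq (c d : Cmd K A) : Cmd K A
  | cases (k : K) (b : Option A → Cmd K A) : Cmd K A
  | loop (k : K) (b : A → Cmd K A) : Cmd K A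

namespace Cmd

variable {K A : Type}

/-- Big-step semantics with a step count: `cases k b` pops from `k` and continues with `b`,
`loop k b` runs `b x` for every symbol `x` popped from `k` until `k` is empty. -/
inductive Exec [DecidableEq K] : Cmd K A → (K → List A) → (K → List A) → ℕ → Prop
  | skip (S) : Exec .skip S S 1
  | push (k x S) : Exec (.push k x) S (Function.update S k (x :: S k)) 1
  | seq {c d S S' S'' t t'} : Exec c S S' t → Exec d S' S'' t' → Exec (.seq c d) S S'' (t + t')
  | cases {k b S S' t} : Exec (b (S k).head?) (Function.update S k (S k).tail) S' t →
      Exec (.cases k b) S S' (1 + t)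
  | loop_nil {k b S} : S k = [] → Exec (.loop k b) S S 1
  | loop_cons {k b S S' S'' x xs t t'} : S k = x :: xs →
      Exec (b x) (Function.update S k xs) S' t → Exec (.loop k b) S' S'' t' →
      Exec (.loop k b) S S'' (1 + (t + t'))

/-- The labels of the machine that runs a program. -/
def Label : Cmd K A → Type
  | skip => Unit
  | push _ _ => Unit
  | seq c d => c.Label ⊕ d.Label
  | cases _ b => Option (Σ o, (b o).Label)
  | loop _ b => Option (Σ x, (b x).Label)

/-- The label at which the machine of a program starts. -/
def entry : (c : Cmd K A) → c.Label
  | skip => ()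
  | push _ _ => ()
  | seq c _ => .inl c.entry
  | cases _ _ => none
  | loop _ _ => none

/-- Every program has finitely many labels. -/
@[reducible] noncomputable def labelFintype [Fintype A] : (c : Cmd K A) → Fintype c.Label
  | skip => inferInstanceAs (Fintype Unit)
  | push _ _ => inferInstanceAs (Fintype Unit)
  | seq c d => by
      letI := c.labelFintype
      letI := d.labelFintype
      exact inferInstanceAs (Fintype (c.Label ⊕ d.Label))
  | cases _ b => by
      letI := fun o => (b o).labelFintype
      exact inferInstanceAs (Fintype (Option (Σ o, (b o).Label)))
  | loop _ b => by
      letI := fun x => (b x).labelFintype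
      exact inferInstanceAs (Fintype (Option (Σ x, (b x).Label)))

variable {K₂ : Type} {Γ₂ : K₂ → Type} {Λ σ₂ : Type}

/-- The alphabets of a machine with the stacks of a program and those of a second machine. -/
abbrev SumΓ (K A : Type) (Γ₂ : K₂ → Type) : K ⊕ K₂ → Type
  | .inl _ => A
  | .inr k => Γ₂ k

/-- The stacks of a program and those of a second machine. -/
def sumStk (S : K → List A) (R : ∀ k, List (Γ₂ k)) : ∀ k, List (SumΓ K A Γ₂ k)
  | .inl k => S k
  | .inr k => R k

/-- The statements of the machine that runs a program: `emb` embeds its labels, and at the end it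
jumps to `exit`. -/
def code : (c : Cmd K A) → (c.Label → Λ) → Λ → c.Label →
    TM2.Stmt (SumΓ K A Γ₂) Λ (Option A × σ₂)
  | skip, _, exit, _ => .goto fun _ => exit
  | push k x, _, exit, _ => .push (.inl k) (fun _ => x) (.goto fun _ => exit)
  | seq c d, emb, _, .inl l => c.code (emb ∘ .inl) (emb (.inr d.entry)) l
  | seq _ d, emb, exit, .inr l => d.code (emb ∘ .inr) exit l
  | cases k b, emb, _, none => .pop (.inl k) (fun v o => (o, v.2))
      (.goto fun v => emb (some ⟨v.1, (b v.1).entry⟩))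
  | cases _ b, emb, exit, some ⟨o, l⟩ => (b o).code (fun l => emb (some ⟨o, l⟩)) exit l
  | loop k b, emb, exit, none => .pop (.inl k) (fun v o => (o, v.2))
      (.goto fun v => v.1.elim exit fun x => emb (some ⟨x, (b x).entry⟩))
  | loop _ b, emb, _, some ⟨x, l⟩ => (b x).code (fun l => emb (some ⟨x, l⟩)) (emb none) l

end Cmd

/-- The machine `m` goes from `a` to `b` in exactly `n` steps. -/
def StepsTo {K : Type} [DecidableEq K] {Γ : K → Type} {Λ σ : Type} (m : Λ → TM2.Stmt Γ Λ σ) (n : ℕ)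
    (a b : TM2.Cfg Γ Λ σ) : Prop :=
  (flip bind (TM2.step m))^[n] (some a) = some b

section StepsTo
variable {K : Type} [DecidableEq K] {Γ : K → Type} {Λ σ : Type} {m : Λ → TM2.Stmt Γ Λ σ}

theorem StepsTo.trans {n n' : ℕ} {a b c : TM2.Cfg Γ Λ σ} (h : StepsTo m n a b)
    (h' : StepsTo m n' b c) : StepsTo m (n + n') a c := by
  unfold StepsTo at *
  rw [add_comm, Function.iterate_add_apply, h, h']

theorem StepsTo.of_label {l : Λ} {q : TM2.Stmt Γ Λ σ} (h : m l = q) {v : σ}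
    {S : ∀ k, List (Γ k)} {b : TM2.Cfg Γ Λ σ} (hb : TM2.stepAux q v S = b) :
    StepsTo m 1 ⟨some l, v, S⟩ b := by
  subst h hb
  rfl

end StepsTo

/-! ### Correctness of the compilation of structured programs -/

namespace Cmd
variable {K A K₂ : Type} [DecidableEq K] [DecidableEq K₂] {Γ₂ : K₂ → Type} {Λ σ₂ : Type}

theorem update_sumStk_inl (S : K → List A) (R : ∀ k, List (Γ₂ k)) (k : K)
    (L : List (SumΓ K A Γ₂ (.inl k))) :
    Function.update (sumStk S R) (.inl k) L = sumStk (Function.update S k L) R := by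
  funext j
  rcases j with j | j
  · by_cases h : j = k
    · subst h; simp [sumStk]
    · simp [sumStk, h]
  · simp [sumStk]

theorem update_sumStk_inr (S : K → List A) (R : ∀ k, List (Γ₂ k)) (k : K₂)
    (L : List (SumΓ K A Γ₂ (.inr k))) :
    Function.update (sumStk S R) (.inr k) L = sumStk S (Function.update R k L) := by
  funext j
  rcases j with j | j
  · simp [sumStk]
  · by_cases h : j = k
    · subst h; simp [sumStk]
    · simp [sumStk, h]

theorem stepAux_loop (k : K) (b : A → Cmd K A) (emb : (loop k b).Label → Λ) (exit : Λ)
    (v : Option A) (u : σ₂) (S : K → List A) (R : ∀ k, List (Γ₂ k)) :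
    TM2.stepAux ((loop k b).code emb exit none) (v, u) (sumStk S R) =
      ⟨some ((S k).head?.elim exit fun x => emb (some ⟨x, (b x).entry⟩)), ((S k).head?, u),
        sumStk (Function.update S k (S k).tail) R⟩ := by
  rw [← update_sumStk_inl]; rfl

/-- The machine of a program follows its semantics. -/
theorem stepsTo_code {m : Λ → TM2.Stmt (SumΓ K A Γ₂) Λ (Option A × σ₂)} {c : Cmd K A}
    {S S' : K → List A} {t : ℕ} (h : Exec c S S' t) (R : ∀ k, List (Γ₂ k)) (u : σ₂) :
    ∀ (emb : c.Label → Λ) (exit : Λ), (∀ l, m (emb l) = c.code emb exit l) → ∀ v : Option A,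
      ∃ v', StepsTo m t ⟨some (emb c.entry), (v, u), sumStk S R⟩
        ⟨some exit, (v', u), sumStk S' R⟩ := by
  induction h with
  | skip S =>
    intro emb exit hm v
    exact ⟨v, .of_label (hm ()) rfl⟩
  | push k x S =>
    intro emb exit hm v
    refine ⟨v, .of_label (hm ()) ?_⟩
    rw [← update_sumStk_inl]; rfl
  | @seq c d S S' S'' t t' _ _ ih ih' =>
    intro emb exit hm v
    obtain ⟨v', h⟩ := ih (emb ∘ .inl) (emb (.inr d.entry)) (fun l => hm (.inl l)) v
    obtain ⟨v'', h'⟩ := ih' (emb ∘ .inr) exit (fun l => hm (.inr l)) v'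
    exact ⟨v'', h.trans h'⟩
  | @cases k b S S' t _ ih =>
    intro emb exit hm v
    obtain ⟨v', h⟩ := ih (fun l => emb (some ⟨_, l⟩)) exit (fun l => hm (some ⟨_, l⟩)) (S k).head?
    refine ⟨v', StepsTo.trans (.of_label (hm none) ?_) h⟩
    rw [← update_sumStk_inl]; rfl
  | @loop_nil k b S hS =>
    intro emb exit hm v
    refine ⟨none, .of_label (hm none) ((stepAux_loop k b emb exit v u S R).trans ?_)⟩
    -- The final test of a loop pops an empty stack, which changes nothing but costs one step.
    have h2 : Function.update S k (S k).tail = S := by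
      rw [hS, List.tail_nil, ← hS, Function.update_eq_self]
    rw [h2, hS]; rfl
  | @loop_cons k b S S' S'' x xs t t' hS _ _ ih ih' =>
    intro emb exit hm v
    obtain ⟨v', h⟩ := ih (fun l => emb (some ⟨_, l⟩)) (emb none)
      (fun l => hm (some ⟨_, l⟩)) (some x)
    obtain ⟨v'', h'⟩ := ih' emb exit hm v'
    refine ⟨v'', StepsTo.trans (.of_label (hm none) ((stepAux_loop k b emb exit v u S R).trans ?_))
      (h.trans h')⟩
    rw [hS]; rfl

/-- A program pushes at most one symbol per step. -/
theorem Exec.length_le {c : Cmd K A} {S S' : K → List A} {t : ℕ} (h : Exec c S S' t) (k : K) :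
    (S' k).length ≤ (S k).length + t := by
  have aux (S : K → List A) (j : K) (L : List A) (hL : L.length ≤ (S j).length) :
      (Function.update S j L k).length ≤ (S k).length := by
    by_cases hk : k = j
    · subst hk; simpa using hL
    · simp [hk]
  induction h with
  | skip S => simp
  | push j x S =>
    by_cases hk : k = j
    · subst hk; simp
    · simp [hk]
  | seq _ _ ih ih' => omega
  | @cases j b S S' t _ ih =>
    have := aux S j (S j).tail (by simp)
    omega
  | loop_nil _ => simp
  | @loop_cons j b S S' S'' x xs t t' hS _ _ ih ih' =>
    have := aux S j xs (by simp [hS])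
    omega

end Cmd

/-! ### Running a program before a given machine -/

section Compose
variable {K A : Type}

/-- The statement `q` of a machine, in the machine that runs a program first. -/
def liftStmt {K₂ : Type} {Γ₂ : K₂ → Type} {Λ₂ σ₂ : Type} (Λ₁ : Type) :
    TM2.Stmt Γ₂ Λ₂ σ₂ → TM2.Stmt (Cmd.SumΓ K A Γ₂) (Λ₁ ⊕ Λ₂) (Option A × σ₂)
  | .push k f q => .push (.inr k) (fun v => f v.2) (liftStmt Λ₁ q)
  | .peek k f q => .peek (.inr k) (fun v o => (v.1, f v.2 o)) (liftStmt Λ₁ q)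
  | .pop k f q => .pop (.inr k) (fun v o => (v.1, f v.2 o)) (liftStmt Λ₁ q)
  | .load f q => .load (fun v => (v.1, f v.2)) (liftStmt Λ₁ q)
  | .branch f q q' => .branch (fun v => f v.2) (liftStmt Λ₁ q) (liftStmt Λ₁ q')
  | .goto f => .goto fun v => .inr (f v.2)
  | .halt => .halt

/-- A configuration of a machine, in the machine that runs a program first. -/
def liftCfg {K₂ : Type} {Γ₂ : K₂ → Type} {Λ₂ σ₂ : Type} (Λ₁ : Type) (c : TM2.Cfg Γ₂ Λ₂ σ₂) :
    TM2.Cfg (Cmd.SumΓ K A Γ₂) (Λ₁ ⊕ Λ₂) (Option A × σ₂) :=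
  ⟨c.l.map .inr, (none, c.var), Cmd.sumStk (fun _ => []) c.stk⟩

variable [DecidableEq K]

/-- Lifted statements never touch the stacks or the register of the program that ran before. Fixing
these as empty and `none` makes the embedding of configurations a function, and this obliges the
first phase to clean up. -/
theorem stepAux_liftStmt {K₂ : Type} [DecidableEq K₂] {Γ₂ : K₂ → Type} {Λ₁ Λ₂ σ₂ : Type}
    (q : TM2.Stmt Γ₂ Λ₂ σ₂) (v : σ₂) (R : ∀ k, List (Γ₂ k)) :
    TM2.stepAux (liftStmt (K := K) (A := A) Λ₁ q) (none, v) (Cmd.sumStk (fun _ => []) R) =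
      liftCfg Λ₁ (TM2.stepAux q v R) := by
  induction q generalizing v R with
  | push k f q ih =>
    simp only [liftStmt, TM2.stepAux, ← ih, ← Cmd.update_sumStk_inr]; rfl
  | peek k f q ih => simp only [liftStmt, TM2.stepAux, ← ih]; rfl
  | pop k f q ih =>
    simp only [liftStmt, TM2.stepAux, ← ih, ← Cmd.update_sumStk_inr]; rfl
  | load f q ih => simp only [liftStmt, TM2.stepAux, ← ih]
  | branch f q q' ih ih' =>
    simp only [liftStmt, TM2.stepAux]
    cases f v
    · exact ih' v R
    · exact ih v R
  | goto f => rfl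
  | halt => rfl

theorem StepsTo.lift {K₂ : Type} [DecidableEq K₂] {Γ₂ : K₂ → Type} {Λ₁ Λ₂ σ₂ : Type}
    {m : Λ₂ → TM2.Stmt Γ₂ Λ₂ σ₂}
    {m' : Λ₁ ⊕ Λ₂ → TM2.Stmt (Cmd.SumΓ K A Γ₂) (Λ₁ ⊕ Λ₂) (Option A × σ₂)}
    (hm : ∀ l, m' (.inr l) = liftStmt Λ₁ (m l)) {n : ℕ} {a b : TM2.Cfg Γ₂ Λ₂ σ₂}
    (h : StepsTo m n a b) : StepsTo m' n (liftCfg Λ₁ a) (liftCfg Λ₁ b) := by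
  -- Stating the commutation on options covers halted configurations as well, so that it can be
  -- iterated.
  have key (o : Option (TM2.Cfg Γ₂ Λ₂ σ₂)) :
      flip bind (TM2.step m') (o.map (liftCfg Λ₁)) =
        (flip bind (TM2.step m) o).map (liftCfg Λ₁) := by
    rcases o with _ | ⟨_ | l, v, R⟩
    · rfl
    · rfl
    · change some (TM2.stepAux (m' (.inr l)) (none, v) (Cmd.sumStk (fun _ => []) R)) = _
      rw [hm, stepAux_liftStmt]; rfl
  have (n : ℕ) (o : Option (TM2.Cfg Γ₂ Λ₂ σ₂)) :
      (flip bind (TM2.step m'))^[n] (o.map (liftCfg Λ₁)) =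
        ((flip bind (TM2.step m))^[n] o).map (liftCfg Λ₁) := by
    induction n generalizing o with
    | zero => rfl
    | succ n ih => rw [Function.iterate_succ_apply, Function.iterate_succ_apply, key, ih]
  have := this n (some a)
  unfold StepsTo at h ⊢
  rw [h] at this
  exact this

variable {B : Type}

/-- The statements of the machine that runs `c`, moves the stack `o` to the input stack of `M` and
then runs `M`. -/
def precompStmt (c : Cmd K A) (o : K) (M : TM2ComputableAux A B) (x₀ : A) :
    (c.Label ⊕ Unit) ⊕ M.tm.Λ →
      TM2.Stmt (Cmd.SumΓ K A M.tm.Γ) ((c.Label ⊕ Unit) ⊕ M.tm.Λ) (Option A × M.tm.σ)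
  | .inl (.inl l) => c.code (.inl ∘ .inl) (.inl (.inr ())) l
  | .inl (.inr _) => .pop (.inl o) (fun v x => (x, v.2)) <|
      .branch (fun v => v.1.isNone) (.goto fun _ => .inr M.tm.main) <|
        .push (.inr M.tm.k₀) (fun v => M.inputAlphabet.symm (v.1.getD x₀)) <|
          .goto fun _ => .inl (.inr ())
  | .inr l => liftStmt _ (M.tm.m l)

/-- The machine that runs `c` with the input stack `i`, moves the stack `o` to the input stack of
`M` and then runs `M`. -/
noncomputable def precomp [Fintype K] [Fintype A] (c : Cmd K A) (i o : K)
    (M : TM2ComputableAux A B) (x₀ : A) : TM2ComputableAux A B where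
  tm :=
    letI := c.labelFintype
    letI := M.tm.ΛFin
    letI := M.tm.σFin
    letI := M.tm.kFin
    { K := K ⊕ M.tm.K
      k₀ := .inl i
      k₁ := .inr M.tm.k₁
      Γ := Cmd.SumΓ K A M.tm.Γ
      Λ := (c.Label ⊕ Unit) ⊕ M.tm.Λ
      main := .inl (.inl c.entry)
      σ := Option A × M.tm.σ
      initialState := (none, M.tm.initialState)
      Γk₀Fin := inferInstanceAs (Fintype A)
      m := precompStmt c o M x₀ }
  inputAlphabet := Equiv.refl A
  outputAlphabet := M.outputAlphabet

theorem stepAux_transfer (c : Cmd K A) (o : K) (M : TM2ComputableAux A B) (x₀ : A) (v : Option A)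
    (u : M.tm.σ) (S : K → List A) (R : ∀ k, List (M.tm.Γ k)) :
    TM2.stepAux (precompStmt c o M x₀ (.inl (.inr ()))) (v, u) (Cmd.sumStk S R) =
      bif (S o).head?.isNone then
        ⟨some (.inr M.tm.main), ((S o).head?, u), Cmd.sumStk (Function.update S o (S o).tail) R⟩
      else ⟨some (.inl (.inr ())), ((S o).head?, u),
        Cmd.sumStk (Function.update S o (S o).tail) (Function.update R M.tm.k₀
          (M.inputAlphabet.symm ((S o).head?.getD x₀) :: R M.tm.k₀))⟩ := by
  rw [← Cmd.update_sumStk_inr, ← Cmd.update_sumStk_inl]; rfl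

/-- Moving a stack symbol by symbol reverses it, so the first phase has to leave its output
reversed. The additional step is the pop of the empty stack; it also resets the register to `none`,
as `liftCfg` requires. -/
theorem stepsTo_transfer (c : Cmd K A) (o : K) (M : TM2ComputableAux A B) (x₀ : A) :
    ∀ (w : List A) (u : List (M.tm.Γ M.tm.k₀)) (v : Option A),
    StepsTo (precompStmt c o M x₀) (w.length + 1)
      ⟨some (.inl (.inr ())), (v, M.tm.initialState),
        Cmd.sumStk (Function.update (fun _ => []) o w) (Function.update (fun _ => []) M.tm.k₀ u)⟩
      ⟨some (.inr M.tm.main), (none, M.tm.initialState),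
        Cmd.sumStk (fun _ => [])
          (Function.update (fun _ => []) M.tm.k₀ ((w.map M.inputAlphabet.symm).reverse ++ u))⟩
  | [], u, v => by
    refine .of_label rfl ((stepAux_transfer ..).trans ?_)
    simp
  | x :: w, u, v => by
    have := stepsTo_transfer c o M x₀ w (M.inputAlphabet.symm x :: u) (some x)
    rw [List.length_cons, add_comm]
    refine StepsTo.trans (.of_label rfl ((stepAux_transfer ..).trans ?_))
      (by simpa only [List.map_cons, List.reverse_cons, List.append_assoc, List.singleton_append]
        using this)
    simp

theorem dite_stack_eq_update {K : Type} (inst : DecidableEq K) {Γ : K → Type} (j : K)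
    (s : List (Γ j)) :
    (fun k => @dite (List (Γ k)) (k = j) (inst k j) (fun h => by rw [h]; exact s) fun _ => []) =
      Function.update (fun _ => []) j s := by
  funext k
  by_cases h : k = j
  · subst h; simp
  · simp [h]

theorem initList_eq (tm : FinTM2) (s : List (tm.Γ tm.k₀)) :
    initList tm s = ⟨some tm.main, tm.initialState, Function.update (fun _ => []) tm.k₀ s⟩ :=
  congrArg (TM2.Cfg.mk _ _) (dite_stack_eq_update ..)

theorem haltList_eq (tm : FinTM2) (s : List (tm.Γ tm.k₁)) :
    haltList tm s = ⟨none, tm.initialState, Function.update (fun _ => []) tm.k₁ s⟩ :=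
  congrArg (TM2.Cfg.mk _ _) (dite_stack_eq_update ..)

/-- If `c` turns `w` into the reverse of `w'` in `t` steps, then to run `c` before `M` on `w` has
the output of `M` on `w'`. -/
theorem precomp_outputs [Fintype K] [Fintype A] (c : Cmd K A) (i o : K)
    (M : TM2ComputableAux A B) (x₀ : A)
    {w w' : List A} {t m : ℕ} {y : List (M.tm.Γ M.tm.k₁)}
    (hc : c.Exec (Function.update (fun _ => []) i w) (Function.update (fun _ => []) o w'.reverse) t)
    (h : Nonempty (TM2OutputsInTime M.tm (w'.map M.inputAlphabet.symm) (some y) m)) :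
    Nonempty (TM2OutputsInTime (precomp c i o M x₀).tm
      (w.map (precomp c i o M x₀).inputAlphabet.symm) (some y) (t + (w'.length + 1) + m)) := by
  obtain ⟨⟨⟨n, hn⟩, hnm⟩⟩ := h
  have h1 : StepsTo M.tm.m n (initList M.tm (w'.map M.inputAlphabet.symm)) (haltList M.tm y) := hn
  have h2 := h1.lift (K := K) (A := A) (Λ₁ := c.Label ⊕ Unit) (m' := precompStmt c o M x₀)
    (fun l => rfl)
  obtain ⟨v', h3⟩ := Cmd.stepsTo_code (m := precompStmt c o M x₀) hc
    (fun _ => ([] : List (M.tm.Γ _))) M.tm.initialState (.inl ∘ .inl) (.inl (.inr ()))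
    (fun l => rfl) none
  have h4 := stepsTo_transfer c o M x₀ w'.reverse [] v'
  rw [initList_eq, haltList_eq] at h2
  have h0 : Function.update (fun k => ([] : List (M.tm.Γ k))) M.tm.k₀ [] = fun _ => [] :=
    Function.update_eq_self _ _
  rw [h0, List.length_reverse, List.map_reverse, List.reverse_reverse, List.append_nil] at h4
  have h5 := (h3.trans h4).trans h2
  have hle : t + (w'.length + 1) + n ≤ t + (w'.length + 1) + m := Nat.add_le_add_left hnm _
  have h6 : Cmd.sumStk (fun _ => []) (fun _ => []) =
      fun k => ([] : List (Cmd.SumΓ K A M.tm.Γ k)) := by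
    funext k; cases k <;> rfl
  have hi : initList (precomp c i o M x₀).tm (w.map (precomp c i o M x₀).inputAlphabet.symm) =
      ⟨some (.inl (.inl c.entry)), (none, M.tm.initialState),
        Cmd.sumStk (Function.update (fun _ => []) i w) fun _ => []⟩ := by
    rw [initList_eq, ← Cmd.update_sumStk_inl, h6]
    exact congrArg (fun l => TM2.Cfg.mk _ _ (Function.update _ _ l)) (List.map_id w)
  have ho : haltList (precomp c i o M x₀).tm y = liftCfg (c.Label ⊕ Unit)
      ⟨none, M.tm.initialState, Function.update (fun _ => []) M.tm.k₁ y⟩ := by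
    rw [liftCfg, ← Cmd.update_sumStk_inr, h6]
    exact haltList_eq _ _
  refine ⟨⟨⟨t + (w'.length + 1) + n, ?_⟩, hle⟩⟩
  rw [hi]
  exact Eq.trans h5 (congrArg some ho.symm)

end Compose

/-! ### The shape of the constructed programs -/

/-- The kinds of blocks of a constructed program: the first block, the further blocks that choose
the index bits, a bit of a token, the end of a token (a literal with its sign, or the end of a
clause), and the last block. -/
inductive Mark
  | start
  | init
  | bit (b : Bool)
  | tag (o : Option Bool)
  | fin
  deriving DecidableEq

/-- A rule relative to two base addresses; an atom `(r, s)` has the address `s` relative to the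
main base if `r = true` and to the back base otherwise. -/
structure Template where
  head : List (Bool × ℕ)
  pos : List (Bool × ℕ)
  neg : List (Bool × ℕ)
  deriving DecidableEq

/-- The atoms of a template. -/
def Template.atoms (t : Template) : List (Bool × ℕ) := t.head ++ (t.pos ++ t.neg)

/-- An atom of the current block; the main base is the start of the block before. -/
abbrev cur (s : ℕ) : Bool × ℕ := (true, 9 + s)
/-- An atom of the preceding block, or of the current block if that is the first one. -/
abbrev prev (s : ℕ) : Bool × ℕ := (true, s)
/-- An atom of the block one period before the current block. -/
abbrev back (s : ℕ) : Bool × ℕ := (false, s)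

/-- The rules that every block has. The atoms of a block are: `0`, `1` the index bit and its
complement, `2` a mismatch of the current token and the index, `3` no literal of the indexed variable
was set to false, `4` none was set to true, `5` all literals of the current clause are falsified,
`6` saturation, `7`, `8` the guessed value and its complement. -/
def commonTemplates (c : ℕ → Bool × ℕ) : List Template :=
  [⟨[c 0], [c 6], []⟩, ⟨[c 1], [c 6], []⟩, ⟨[c 2], [c 6], []⟩, ⟨[c 3], [c 6], []⟩,
    ⟨[c 4], [c 6], []⟩, ⟨[c 7, c 8], [], []⟩]

/-- Saturation spreads to the adjacent blocks. -/
def linkTemplates : List Template := [⟨[prev 6], [cur 6], []⟩, ⟨[cur 6], [prev 6], []⟩]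

/-- An atom holds in the current block if it holds in the preceding one. -/
abbrev keep (s : ℕ) : Template := ⟨[cur s], [prev s], []⟩

/-- The rules of a block. -/
def templates : Mark → List Template
  | .start => commonTemplates prev ++
    [⟨[prev 0, prev 1], [], []⟩, ⟨[prev 3], [], []⟩, ⟨[prev 4], [], []⟩, ⟨[prev 5], [], []⟩,
      ⟨[], [], [prev 6]⟩]
  | .init => commonTemplates cur ++ linkTemplates ++
    [⟨[cur 0, cur 1], [], []⟩, keep 3, keep 4, keep 5]
  | .bit b => commonTemplates cur ++ linkTemplates ++
    [⟨[cur 0], [back 0], []⟩, ⟨[cur 1], [back 1], []⟩, keep 2,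
      ⟨[cur 2], [cur (if b then 1 else 0)], []⟩, keep 3, keep 4, keep 5]
  | .tag (some b) => commonTemplates cur ++ linkTemplates ++
    [⟨[cur 0], [back 0], []⟩, ⟨[cur 1], [back 1], []⟩,
      ⟨[cur 3], [prev 2, prev 3], []⟩, ⟨[cur 3], [prev 3, cur 7], []⟩,
      ⟨[cur 4], [prev 2, prev 4], []⟩, ⟨[cur 4], [prev 4, cur 8], []⟩,
      ⟨[cur 5], [prev 5, cur (if b then 8 else 7)], []⟩]
  | .tag none => commonTemplates cur ++ linkTemplates ++
    [⟨[cur 0], [back 0], []⟩, ⟨[cur 1], [back 1], []⟩, keep 3, keep 4,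
      ⟨[cur 5], [], []⟩, ⟨[], [prev 5, cur 5], []⟩]
  | .fin => commonTemplates cur ++ linkTemplates ++
    [keep 3, keep 4, keep 5, ⟨[cur 6], [cur 3], []⟩, ⟨[cur 6], [cur 4], []⟩]

/-- The marks whose blocks refer to the block one period before. -/
def Mark.UsesBack : Mark → Prop
  | .bit _ => True
  | .tag _ => True
  | _ => False

/-- The first relative address of the current block. -/
def Mark.low : Mark → ℕ
  | .start => 0
  | _ => 9

/-- The lexicographic order of relative addresses. -/
def AtomLT (x y : Bool × ℕ) : Prop := x.1 = y.1 ∧ x.2 < y.2 ∨ x.1 = false ∧ y.1 = true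

instance : DecidableRel AtomLT := fun x y => by unfold AtomLT; infer_instance

/-- Templates that yield rules in normal form. -/
structure Template.WellFormed (m : Mark) (t : Template) : Prop where
  head_sorted : t.head.Pairwise AtomLT
  pos_sorted : t.pos.Pairwise AtomLT
  neg_sorted : t.neg.Pairwise AtomLT
  disjoint : t.head.Disjoint t.pos ∧ t.head.Disjoint t.neg ∧ t.pos.Disjoint t.neg
  length_le : t.atoms.length ≤ 3
  lt_high : ∀ x ∈ t.atoms, x.1 = true → x.2 < m.low + 9
  lt_nine : ∀ x ∈ t.atoms, x.1 = false → x.2 < 9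
  exists_low : ∃ x ∈ t.atoms, x.1 = true ∧ m.low ≤ x.2

/-- There are eight marks with concrete lists of templates, so evaluation settles the claim once
disjointness is spelled out as a decidable statement. -/
theorem wellFormed_of_mem {m : Mark} {t : Template} (h : t ∈ templates m) : t.WellFormed m := by
  have key : ∀ t ∈ templates m, t.head.Pairwise AtomLT ∧ t.pos.Pairwise AtomLT ∧
      t.neg.Pairwise AtomLT ∧ ((∀ x ∈ t.head, x ∉ t.pos) ∧ (∀ x ∈ t.head, x ∉ t.neg) ∧
      (∀ x ∈ t.pos, x ∉ t.neg)) ∧ t.atoms.length ≤ 3 ∧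
      (∀ x ∈ t.atoms, x.1 = true → x.2 < m.low + 9) ∧ (∀ x ∈ t.atoms, x.1 = false → x.2 < 9) ∧
      ∃ x ∈ t.atoms, x.1 = true ∧ m.low ≤ x.2 := by
    rcases m with _ | _ | (_ | _) | (_ | _ | _) | _ <;> decide
  obtain ⟨h1, h2, h3, ⟨h4, h5, h6⟩, h7, h8, h9, h10⟩ := key t h
  exact ⟨h1, h2, h3, ⟨fun x hx hy => h4 x hx hy, fun x hx hy => h5 x hx hy,
    fun x hx hy => h6 x hx hy⟩, h7, h8, h9, h10⟩

theorem nodup_templates (m : Mark) : (templates m).Nodup := by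
  rcases m with _ | _ | (_ | _) | (_ | _ | _) | _ <;> decide

theorem length_templates_le (m : Mark) : (templates m).length ≤ 15 := by
  rcases m with _ | _ | (_ | _) | (_ | _ | _) | _ <;> decide

/-- Together with `Layout.le_of_usesBack` this ensures that the truncation in `q - p` is never
visible in a rule. -/
theorem usesBack_of_mem {m : Mark} {t : Template} (h : t ∈ templates m) {x : Bool × ℕ}
    (hx : x ∈ t.atoms) (hx1 : x.1 = false) : m.UsesBack := by
  have key : m.UsesBack ∨ ∀ t ∈ templates m, ∀ x ∈ t.atoms, x.1 = true := by
    rcases m with _ | _ | (_ | _) | (_ | _ | _) | _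
    · right; decide
    · right; decide
    · exact .inl trivial
    · exact .inl trivial
    · exact .inl trivial
    · exact .inl trivial
    · exact .inl trivial
    · right; decide
  rcases key with h' | h'
  · exact h'
  · simp [h' t h x hx] at hx1

/-- Every address of a block occurs in one of its own rules; hence the atoms of a program form an
initial segment of `ℕ`, as the input format demands. -/
theorem exists_template_of_lt (m : Mark) {s : ℕ} (hs : s < 9) :
    ∃ t ∈ templates m, (true, m.low + s) ∈ t.atoms := by
  have key : ∀ s < 9, ∃ t ∈ templates m, (true, m.low + s) ∈ t.atoms := by
    rcases m with _ | _ | (_ | _) | (_ | _ | _) | _ <;> decide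
  exact key s hs

/-- The absolute address of an atom. -/
def addr (b k : ℕ) (x : Bool × ℕ) : ℕ := (bif x.1 then b else k) + x.2

/-- The rule with given lists of atoms, which ought to be disjoint. -/
def Rule.ofLists (h p n : List ℕ) : Rule ℕ where
  head := h.toFinset
  pos := p.toFinset \ h.toFinset
  neg := n.toFinset \ (h.toFinset ∪ p.toFinset)
  disjoint_head_pos := Finset.disjoint_sdiff
  disjoint_head_neg := Finset.disjoint_sdiff.mono_left Finset.subset_union_left
  disjoint_pos_neg := Finset.disjoint_sdiff.mono_left
    (Finset.sdiff_subset.trans Finset.subset_union_right)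

/-- The rule of a template for given base addresses. -/
def Template.toRule (b k : ℕ) (t : Template) : Rule ℕ :=
  Rule.ofLists (t.head.map (addr b k)) (t.pos.map (addr b k)) (t.neg.map (addr b k))

section addr
variable {b k : ℕ}

/-- The condition `k + 9 ≤ b` puts the nine back addresses below all main ones, so the lexicographic
order of relative addresses becomes the order of `ℕ`. -/
theorem addr_lt {x y : Bool × ℕ} (hx : x.1 = false → k + 9 ≤ b ∧ x.2 < 9) (h : AtomLT x y) :
    addr b k x < addr b k y := by
  obtain ⟨_ | _, s⟩ := x <;> obtain ⟨_ | _, s'⟩ := y <;> simp [AtomLT, addr] at * <;> omega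

theorem addr_inj {x y : Bool × ℕ} (hx : x.1 = false → k + 9 ≤ b ∧ x.2 < 9)
    (hy : y.1 = false → k + 9 ≤ b ∧ y.2 < 9) (h : addr b k x = addr b k y) : x = y := by
  obtain ⟨_ | _, s⟩ := x <;> obtain ⟨_ | _, s'⟩ := y <;> simp [addr] at * <;> omega

end addr

/-- The base addresses `b`, `k` keep the atoms of the template apart. -/
def Template.Fits (b k : ℕ) (t : Template) : Prop :=
  ∀ x ∈ t.atoms, x.1 = false → k + 9 ≤ b ∧ x.2 < 9

/-! ### Rules obtained from templates at given base addresses -/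

namespace Template
variable {b k : ℕ} {t : Template} {m : Mark}

theorem sorted_map (hf : t.Fits b k) {l : List (Bool × ℕ)} (hl : l ⊆ t.atoms)
    (h : l.Pairwise AtomLT) : (l.map (addr b k)).SortedLT := by
  rw [List.sortedLT_iff_pairwise, List.pairwise_map]
  exact h.imp_of_mem fun hx _ hxy => addr_lt (hf _ (hl hx)) hxy

theorem disjoint_map (hf : t.Fits b k) {l l' : List (Bool × ℕ)} (hl : l ⊆ t.atoms)
    (hl' : l' ⊆ t.atoms) (h : l.Disjoint l') {a : ℕ} (ha : a ∈ l.map (addr b k)) :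
    a ∉ l'.map (addr b k) := by
  rintro ha'
  obtain ⟨x, hx, rfl⟩ := List.mem_map.1 ha
  obtain ⟨y, hy, hxy⟩ := List.mem_map.1 ha'
  obtain rfl := addr_inj (hf _ (hl' hy)) (hf _ (hl hx)) hxy
  exact h hx hy

theorem head_subset : t.head ⊆ t.atoms := fun x hx => by simp [atoms, hx]
theorem pos_subset : t.pos ⊆ t.atoms := fun x hx => by simp [atoms, hx]
theorem neg_subset : t.neg ⊆ t.atoms := fun x hx => by simp [atoms, hx]

theorem toRule_head : (t.toRule b k).head = (t.head.map (addr b k)).toFinset := rfl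

/-- The set differences in `Rule.ofLists` serve only to make the rule well defined for all lists;
for well-formed templates they remove nothing. -/
theorem toRule_pos (hw : t.WellFormed m) (hf : t.Fits b k) :
    (t.toRule b k).pos = (t.pos.map (addr b k)).toFinset := by
  refine Finset.sdiff_eq_self_of_disjoint (Finset.disjoint_left.2 fun a ha ha' => ?_)
  exact disjoint_map hf head_subset pos_subset hw.disjoint.1 (List.mem_toFinset.1 ha')
    (List.mem_toFinset.1 ha)

theorem toRule_neg (hw : t.WellFormed m) (hf : t.Fits b k) :
    (t.toRule b k).neg = (t.neg.map (addr b k)).toFinset := by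
  refine Finset.sdiff_eq_self_of_disjoint (Finset.disjoint_left.2 fun a ha ha' => ?_)
  rcases Finset.mem_union.1 ha' with ha' | ha'
  · exact disjoint_map hf head_subset neg_subset hw.disjoint.2.1 (List.mem_toFinset.1 ha')
      (List.mem_toFinset.1 ha)
  · exact disjoint_map hf pos_subset neg_subset hw.disjoint.2.2 (List.mem_toFinset.1 ha')
      (List.mem_toFinset.1 ha)

theorem toRule_atoms (hw : t.WellFormed m) (hf : t.Fits b k) :
    (t.toRule b k).atoms = (t.atoms.map (addr b k)).toFinset := by
  rw [Rule.atoms, toRule_pos hw hf, toRule_neg hw hf, toRule_head]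
  simp [atoms]

/-- The addresses are already increasing, so sorting returns the same list. The machine can thus
write the atoms in the order of the template. -/
theorem encodeMarked_map (hf : t.Fits b k) {l : List (Bool × ℕ)} (hl : l ⊆ t.atoms)
    (h : l.Pairwise AtomLT) (tag : Symbol) :
    encodeMarked tag (l.map (addr b k)).toFinset =
      (l.map (addr b k)).flatMap fun a => List.replicate a Symbol.tick ++ [tag] := by
  have := sorted_map hf hl h
  rw [encodeMarked, (List.toFinset_sort _ this.nodup).2 (this.pairwise.imp le_of_lt)]

theorem map_inj_of_mem {α β : Type*} {f : α → β} :
    ∀ {l l' : List α}, (∀ x ∈ l, ∀ y ∈ l', f x = f y → x = y) → l.map f = l'.map f → l = l'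
  | [], [], _, _ => rfl
  | x :: l, y :: l', h, he => by
    rw [List.map_cons, List.map_cons, List.cons.injEq] at he
    rw [h x (by simp) y (by simp) he.1, map_inj_of_mem (fun x hx y hy => h x (by simp [hx]) y
      (by simp [hy])) he.2]

/-- An increasing list is recovered from its set of entries, and addresses determine relative atoms.
This excludes repeated rules within a block. -/
theorem toRule_injOn {t' : Template} {m' : Mark} (hw : t.WellFormed m) (hw' : t'.WellFormed m')
    (hf : t.Fits b k) (hf' : t'.Fits b k) (h : t.toRule b k = t'.toRule b k) : t = t' := by
  have key {l l' : List (Bool × ℕ)} (hl : l ⊆ t.atoms) (hl' : l' ⊆ t'.atoms)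
      (hs : l.Pairwise AtomLT) (hs' : l'.Pairwise AtomLT)
      (heq : (l.map (addr b k)).toFinset = (l'.map (addr b k)).toFinset) : l = l' := by
    have h1 := sorted_map hf hl hs
    have h2 := sorted_map hf' hl' hs'
    have h3 := (List.toFinset_sort _ h1.nodup).2 (h1.pairwise.imp le_of_lt)
    have h4 := (List.toFinset_sort _ h2.nodup).2 (h2.pairwise.imp le_of_lt)
    rw [heq, h4] at h3
    exact map_inj_of_mem (fun x hx y hy => addr_inj (hf x (hl hx)) (hf' y (hl' hy))) h3.symm
  have e1 : t.head = t'.head := key head_subset head_subset hw.head_sorted hw'.head_sorted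
    (congrArg Rule.head h)
  have e2 : t.pos = t'.pos := key pos_subset pos_subset hw.pos_sorted hw'.pos_sorted (by
    rw [← toRule_pos hw hf, ← toRule_pos hw' hf', h])
  have e3 : t.neg = t'.neg := key neg_subset neg_subset hw.neg_sorted hw'.neg_sorted (by
    rw [← toRule_neg hw hf, ← toRule_neg hw' hf', h])
  cases t; cases t'
  simp_all

/-- The encoding of the rule of a template. -/
theorem encodeRule_toRule (hw : t.WellFormed m) (hf : t.Fits b k) :
    encodeRule (t.toRule b k) =
      ((t.head.map (addr b k)).flatMap fun a => List.replicate a Symbol.tick ++ [.head]) ++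
      ((t.pos.map (addr b k)).flatMap fun a => List.replicate a Symbol.tick ++ [.pos]) ++
      ((t.neg.map (addr b k)).flatMap fun a => List.replicate a Symbol.tick ++ [.neg]) ++
      [.sep] := by
  rw [encodeRule, toRule_pos hw hf, toRule_neg hw hf, toRule_head,
    encodeMarked_map hf head_subset hw.head_sorted, encodeMarked_map hf pos_subset hw.pos_sorted,
    encodeMarked_map hf neg_subset hw.neg_sorted]

end Template

/-! ### Programs that consist of blocks -/

/-- A sequence of marks that fits the period `p`. -/
structure Layout (p : ℕ) (chr : ℕ → Mark) : Prop where
  two_le : 2 ≤ p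
  start_iff : ∀ q, chr q = .start ↔ q = 0
  le_of_usesBack : ∀ q, (chr q).UsesBack → p ≤ q

/-- The rules of the block `q`. -/
def blockRules (p : ℕ) (chr : ℕ → Mark) (q : ℕ) : List (Rule ℕ) :=
  (templates (chr q)).map (Template.toRule (9 * (q - 1)) (9 * (q - p)))

/-- The rules of the first `Q` blocks. -/
def ruleList (p : ℕ) (chr : ℕ → Mark) (Q : ℕ) : List (Rule ℕ) :=
  (List.range Q).flatMap (blockRules p chr)

open Classical in
/-- The program that consists of the first `Q` blocks. -/
noncomputable def blockProgram (p : ℕ) (chr : ℕ → Mark) (Q : ℕ) : Program ℕ :=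
  (ruleList p chr Q).toFinset

section Layout
variable {p : ℕ} {chr : ℕ → Mark} {q Q : ℕ} {t : Template}

theorem mem_blockProgram {r : Rule ℕ} : r ∈ blockProgram p chr Q ↔
    ∃ q < Q, ∃ t ∈ templates (chr q), t.toRule (9 * (q - 1)) (9 * (q - p)) = r := by
  simp [blockProgram, ruleList, blockRules]

namespace Layout
variable (hL : Layout p chr)
include hL

/-- The period is at least two, so the block one period back ends before the preceding block begins.
-/
theorem fits (ht : t ∈ templates (chr q)) : t.Fits (9 * (q - 1)) (9 * (q - p)) := by
  intro x hx hx1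
  have h1 := hL.le_of_usesBack q (usesBack_of_mem ht hx hx1)
  have h2 := hL.two_le
  exact ⟨by omega, (wellFormed_of_mem ht).lt_nine x hx hx1⟩

/-- The first block has no predecessor: there the truncated base is `0` and so is `low`. For all
others the base lies one block too low and `low = 9` compensates. -/
theorem base_add_low : 9 * (q - 1) + (chr q).low = 9 * q := by
  have h := hL.start_iff q
  cases hc : chr q <;> simp [hc, Mark.low] at h ⊢ <;> omega

/-- Locality of the rules: they reach back by at most one period. Both bandwidth bounds rest on
this. -/
theorem atoms_bounds (ht : t ∈ templates (chr q)) {a : ℕ}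
    (ha : a ∈ (t.toRule (9 * (q - 1)) (9 * (q - p))).atoms) :
    9 * q ≤ a + 9 * p ∧ a < 9 * (q + 1) := by
  have hw := wellFormed_of_mem ht
  rw [Template.toRule_atoms hw (hL.fits ht), List.mem_toFinset] at ha
  obtain ⟨⟨_ | _, s⟩, hx, rfl⟩ := List.mem_map.1 ha
  · have h1 := hL.le_of_usesBack q (usesBack_of_mem ht hx rfl)
    have h2 := hw.lt_nine _ hx rfl
    have h3 := hL.two_le
    simp only [addr, cond_false] at h2 ⊢
    omega
  · have h2 := hw.lt_high _ hx rfl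
    have h3 := hL.two_le
    have h4 := hL.base_add_low (q := q)
    simp only [addr, cond_true] at h2 ⊢
    omega

/-- Every rule is anchored in its own block. For this reason the constraint at the end of a clause
also mentions the fact `cur 5`. -/
theorem exists_atom (ht : t ∈ templates (chr q)) :
    ∃ a ∈ (t.toRule (9 * (q - 1)) (9 * (q - p))).atoms, 9 * q ≤ a := by
  have hw := wellFormed_of_mem ht
  obtain ⟨⟨r, s⟩, hx, h1, h2⟩ := hw.exists_low
  simp only at h1 h2
  subst h1
  refine ⟨9 * (q - 1) + s, ?_, ?_⟩
  · rw [Template.toRule_atoms hw (hL.fits ht), List.mem_toFinset]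
    exact List.mem_map_of_mem hx
  · have h4 := hL.base_add_low (q := q)
    omega

/-- The largest atom of a rule lies in the block to which the rule belongs, so the rule reveals its
block. -/
theorem block_unique {q' : ℕ} {t' : Template} (ht : t ∈ templates (chr q))
    (ht' : t' ∈ templates (chr q'))
    (h : t.toRule (9 * (q - 1)) (9 * (q - p)) = t'.toRule (9 * (q' - 1)) (9 * (q' - p))) :
    q = q' := by
  obtain ⟨a, ha, hqa⟩ := hL.exists_atom ht
  obtain ⟨a', ha', hqa'⟩ := hL.exists_atom ht'
  have h1 := (hL.atoms_bounds ht' (h ▸ ha)).2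
  have h2 := (hL.atoms_bounds ht (h ▸ ha')).2
  omega

theorem nodup_ruleList : (ruleList p chr Q).Nodup := by
  rw [ruleList, List.nodup_flatMap]
  refine ⟨fun q _ => ?_, List.nodup_range.imp fun {q q'} hne => ?_⟩
  · refine (nodup_templates _).map_on fun t ht t' ht' h => ?_
    exact Template.toRule_injOn (wellFormed_of_mem ht) (wellFormed_of_mem ht') (hL.fits ht)
      (hL.fits ht') h
  · rintro r hr hr'
    obtain ⟨t, ht, rfl⟩ := List.mem_map.1 hr
    obtain ⟨t', ht', h⟩ := List.mem_map.1 hr'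
    exact hne (hL.block_unique ht ht' h.symm)

theorem lists_ruleList : Lists (ruleList p chr Q) (blockProgram p chr Q) :=
  ⟨hL.nodup_ruleList, fun x => by simp [blockProgram]⟩

theorem isNormalized : (blockProgram p chr Q).IsNormalized := by
  intro r hr
  obtain ⟨q, _, t, ht, rfl⟩ := mem_blockProgram.1 hr
  rw [Template.toRule_atoms (wellFormed_of_mem ht) (hL.fits ht)]
  exact (List.toFinset_card_le _).trans
    ((List.length_map _).trans_le (wellFormed_of_mem ht).length_le)

theorem atoms_blockProgram : (blockProgram p chr Q).atoms = Finset.range (9 * Q) := by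
  ext a
  simp only [Program.atoms, Finset.mem_biUnion, mem_blockProgram, Finset.mem_range]
  constructor
  · rintro ⟨_, ⟨q, hq, t, ht, rfl⟩, ha⟩
    have := (hL.atoms_bounds ht ha).2
    omega
  · intro ha
    obtain ⟨t, ht, hs⟩ := exists_template_of_lt (chr (a / 9)) (Nat.mod_lt a (by norm_num))
    refine ⟨_, ⟨a / 9, by omega, t, ht, rfl⟩, ?_⟩
    rw [Template.toRule_atoms (wellFormed_of_mem ht) (hL.fits ht), List.mem_toFinset]
    refine List.mem_map.2 ⟨_, hs, ?_⟩
    have := hL.base_add_low (q := a / 9)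
    simp only [addr, cond_true]
    omega

end Layout
end Layout

/-! ### Bandwidth -/

/-- Closing the gaps of an injective labelling while keeping its order can only shrink distances. A
one-sided inequality suffices because adjacency is symmetric. -/
theorem bandwidth_le_of_injective {V : Type*} [Finite V] (G : SimpleGraph V) (g : V → ℕ)
    (hg : Function.Injective g) (b : ℕ) (h : ∀ u v, G.Adj u v → g u ≤ g v + b) :
    bandwidth G ≤ b := by
  classical
  have := Fintype.ofFinite V
  set s : Finset ℕ := Finset.univ.image g with hs
  have hcard : s.card = Nat.card V := by
    rw [hs, Finset.card_image_of_injective _ hg, Nat.card_eq_fintype_card, Finset.card_univ]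
  let e : V ≃ s := (Equiv.ofInjective g hg).trans (Equiv.setCongr (by ext; simp [hs]))
  have he (v : V) : (e v : ℕ) = g v := rfl
  let f : V ≃ Fin (Nat.card V) := e.trans (s.orderIsoOfFin hcard).symm.toEquiv
  have hf (i : Fin (Nat.card V)) : g (f.symm i) = s.orderEmbOfFin hcard i := by
    rw [← he]; simp [f]
  -- The labels increase by at least one from each rank to the next, so differences of ranks are at
  -- most differences of labels.
  have key (i j : Fin (Nat.card V)) (hij : i ≤ j) :
      g (f.symm i) + ((j : ℕ) - i) ≤ g (f.symm j) := by
    rw [hf, hf]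
    obtain ⟨j, hj⟩ := j
    obtain ⟨i, hi⟩ := i
    simp only [Fin.mk_le_mk] at hij ⊢
    induction j, hij using Nat.le_induction with
    | base => simp
    | succ j hij ih =>
      have := ih (by omega)
      have h2 : s.orderEmbOfFin hcard ⟨j, by omega⟩ < s.orderEmbOfFin hcard ⟨j + 1, hj⟩ :=
        (s.orderEmbOfFin hcard).strictMono (by simp)
      omega
  refine Nat.sInf_le ⟨f, fun u v huv => ?_⟩
  have h1 := h u v huv
  have h2 := h v u huv.symm
  rw [abs_le]
  rcases le_total (f u) (f v) with hle | hle
  · have := key _ _ hle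
    simp only [Equiv.symm_apply_apply] at this
    have hle' : (f u : ℕ) ≤ f v := hle
    constructor <;> omega
  · have := key _ _ hle
    simp only [Equiv.symm_apply_apply] at this
    have hle' : (f v : ℕ) ≤ f u := hle
    constructor <;> omega

theorem Layout.bandwidth_primalGraph_le {p : ℕ} {chr : ℕ → Mark} {Q : ℕ} (hL : Layout p chr) :
    bandwidth (blockProgram p chr Q).primalGraph ≤ 9 * (p + 1) := by
  refine bandwidth_le_of_injective _ (fun a => a.1) Subtype.val_injective _ ?_
  rintro a a' ⟨-, r, hr, ha, ha'⟩
  obtain ⟨q, _, t, ht, rfl⟩ := mem_blockProgram.1 hr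
  have h1 := hL.atoms_bounds ht ha
  have h2 := hL.atoms_bounds ht ha'
  omega

theorem Layout.bandwidth_incidenceGraph_le {p : ℕ} {chr : ℕ → Mark} {Q : ℕ} (hL : Layout p chr) :
    bandwidth (blockProgram p chr Q).incidenceGraph ≤ 24 * (p + 1) := by
  have hex (r : {r // r ∈ blockProgram p chr Q}) : ∃ qi : ℕ × ℕ, ∃ t : Template,
      (templates (chr qi.1))[qi.2]? = some t ∧
        t.toRule (9 * (qi.1 - 1)) (9 * (qi.1 - p)) = r.1 := by
    obtain ⟨q, _, t, ht, h⟩ := mem_blockProgram.1 r.2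
    obtain ⟨i, hi, rfl⟩ := List.getElem_of_mem ht
    exact ⟨(q, i), _, List.getElem?_eq_getElem hi, h⟩
  choose qi t ht htr using hex
  have hi (r) : (qi r).2 < 15 :=
    (List.getElem?_eq_some_iff.1 (ht r)).1.trans_le (length_templates_le _)
  have hqi (r r') (h : qi r = qi r') : r = r' := by
    have h1 := ht r
    rw [h, ht r', Option.some.injEq] at h1
    exact Subtype.ext ((htr r).symm.trans (by rw [h, ← h1, htr r']))
  -- Each block receives 24 consecutive labels: nine for its atoms, then fifteen for its rules.
  let g : {a // a ∈ (blockProgram p chr Q).atoms} ⊕ {r // r ∈ blockProgram p chr Q} → ℕ :=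
    Sum.elim (fun a => 24 * (a.1 / 9) + a.1 % 9) (fun r => 24 * (qi r).1 + 9 + (qi r).2)
  have hg : Function.Injective g := by
    rintro (⟨a, _⟩ | r) (⟨a', _⟩ | r') h
    · simp only [g, Sum.elim_inl] at h
      congr 2; omega
    · have := hi r'
      simp only [g, Sum.elim_inl, Sum.elim_inr] at h
      omega
    · have := hi r
      simp only [g, Sum.elim_inl, Sum.elim_inr] at h
      omega
    · have h1 := hi r
      have h2 := hi r'
      simp only [g, Sum.elim_inr] at h
      exact congrArg _ (hqi r r' (Prod.ext (by omega) (by omega)))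
  have key (a r) (h : a.1 ∈ r.1.atoms) : g (.inl a) ≤ g (.inr r) + 24 * (p + 1) ∧
      g (.inr r) ≤ g (.inl a) + 24 * (p + 1) := by
    have h1 := hL.atoms_bounds (List.mem_of_getElem? (ht r)) ((htr r).symm ▸ h)
    have h2 := hi r
    simp only [g, Sum.elim_inl, Sum.elim_inr]
    omega
  refine bandwidth_le_of_injective _ g hg _ ?_
  rintro (a | r) (a' | r') h
  · exact h.elim
  · exact (key a r' h).1
  · exact (key a' r h).2
  · exact h.elim


/-! ### Formulas as sequences of tokens -/

/-- A literal (a variable with its sign), or the end of a clause. -/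
abbrev Token := ℕ × Option Bool

/-- The tokens of a clause. -/
def clauseTokens (C : Clause) : List Token :=
  (C.pos.sort (· ≤ ·)).map (fun a => (a, some true)) ++
    ((C.neg.sort (· ≤ ·)).map (fun a => (a, some false)) ++ [(0, none)])

/-- Whether all literals of the current clause up to and including the token `t` are falsified, if
`f` tells this for the preceding token. -/
def falsifyStep (σ : ℕ → Bool) (f : Bool) (t : Token) : Bool :=
  t.2.elim true fun s => f && (σ t.1 != s)

/-- No clause ends with all its literals falsified. -/
def NoneFalsified (σ : ℕ → Bool) (f : Bool) (ts : List Token) : Prop :=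
  ∀ k < ts.length, (ts.getD k (0, none)).2 = none → (ts.take k).foldl (falsifyStep σ) f = false

theorem noneFalsified_cons {σ : ℕ → Bool} {f : Bool} {t : Token} {ts : List Token} :
    NoneFalsified σ f (t :: ts) ↔
      (t.2 = none → f = false) ∧ NoneFalsified σ (falsifyStep σ f t) ts := by
  constructor
  · intro h
    exact ⟨fun ht => by simpa using h 0 (by simp) (by simpa using ht),
      fun k hk hk' => by simpa using h (k + 1) (by simpa using hk) (by simpa using hk')⟩
  · rintro ⟨h1, h2⟩ (_ | k) hk hk'
    · simpa using h1 (by simpa using hk')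
    · simpa using h2 k (by simpa using hk) (by simpa using hk')

/-- The flag survives the literals of a clause iff it was set before and all of them are false. The
separator tests it and sets it to `true` again. -/
theorem noneFalsified_append {σ : ℕ → Bool} {ts ts' : List Token} (f : Bool)
    (h : ∀ t ∈ ts, t.2 ≠ none) : NoneFalsified σ f (ts ++ (0, none) :: ts') ↔
      ¬ (f = true ∧ ∀ t ∈ ts, t.2 ≠ some (σ t.1)) ∧ NoneFalsified σ true ts' := by
  induction ts generalizing f with
  | nil => simp [noneFalsified_cons, falsifyStep]
  | cons t ts ih =>
    obtain ⟨i, _ | s⟩ := t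
    · exact absurd rfl (h (i, none) (by simp))
    · rw [List.cons_append, noneFalsified_cons, ih _ fun t ht => h t (by simp [ht])]
      simp only [falsifyStep, Option.elim, List.forall_mem_cons, ne_eq, reduceCtorEq,
        false_implies, true_and, Bool.and_eq_true, bne_iff_ne, Option.some.injEq, and_assoc,
        eq_comm (a := s)]

theorem noneFalsified_iff (σ : ℕ → Bool) (l : List Clause) :
    NoneFalsified σ true (l.flatMap clauseTokens) ↔
      ∀ C ∈ l, (∃ x ∈ C.pos, σ x = true) ∨ ∃ x ∈ C.neg, σ x = false := by
  induction l with
  | nil => simp [NoneFalsified]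
  | cons C l ih =>
    have e : (C :: l).flatMap clauseTokens =
        ((C.pos.sort (· ≤ ·)).map (fun a => (a, some true)) ++
          (C.neg.sort (· ≤ ·)).map (fun a => (a, some false))) ++
          (0, none) :: l.flatMap clauseTokens := by
      simp [clauseTokens]
    rw [e, noneFalsified_append, ih, List.forall_mem_cons]
    · refine and_congr_left fun _ => ?_
      simp only [true_and, List.forall_mem_append, List.forall_mem_map, Finset.mem_sort, ne_eq,
        Option.some.injEq, not_and_or, not_forall, not_not, exists_prop, eq_comm (a := true),
        eq_comm (a := false)]
    · simp only [List.forall_mem_append, List.forall_mem_map]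
      exact ⟨fun _ _ => by simp, fun _ _ => by simp⟩

/-! ### Models of the reduct of a program of blocks -/

/-- The rules that every block has, for the truth values `c` of its atoms. -/
def CommonSat (c : ℕ → Prop) : Prop :=
  (c 6 → c 0) ∧ (c 6 → c 1) ∧ (c 6 → c 2) ∧ (c 6 → c 3) ∧ (c 6 → c 4) ∧ (c 7 ∨ c 8)

/-- The rules without negation of a block, for the truth values `c` of its atoms, `r` of those of
the preceding block, and `k` of those of the block one period before. -/
def BlockSat (c r k : ℕ → Prop) : Mark → Prop
  | .start => CommonSat c ∧ (c 0 ∨ c 1) ∧ c 3 ∧ c 4 ∧ c 5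
  | .init => CommonSat c ∧ (c 6 ↔ r 6) ∧ (c 0 ∨ c 1) ∧ (r 3 → c 3) ∧ (r 4 → c 4) ∧ (r 5 → c 5)
  | .bit b => CommonSat c ∧ (c 6 ↔ r 6) ∧ (k 0 → c 0) ∧ (k 1 → c 1) ∧ (r 2 → c 2) ∧
      (c (if b then 1 else 0) → c 2) ∧ (r 3 → c 3) ∧ (r 4 → c 4) ∧ (r 5 → c 5)
  | .tag (some b) => CommonSat c ∧ (c 6 ↔ r 6) ∧ (k 0 → c 0) ∧ (k 1 → c 1) ∧
      (r 3 → r 2 → c 3) ∧ (c 7 → r 3 → c 3) ∧ (r 4 → r 2 → c 4) ∧ (c 8 → r 4 → c 4) ∧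
      (c (if b then 8 else 7) → r 5 → c 5)
  | .tag none => CommonSat c ∧ (c 6 ↔ r 6) ∧ (k 0 → c 0) ∧ (k 1 → c 1) ∧ (r 3 → c 3) ∧
      (r 4 → c 4) ∧ c 5 ∧ (c 5 → ¬ r 5)
  | .fin => CommonSat c ∧ (c 6 ↔ r 6) ∧ (r 3 → c 3) ∧ (r 4 → c 4) ∧ (r 5 → c 5) ∧ (c 3 → c 6) ∧
      (c 4 → c 6)

/-- The only negation is in the rule `← ¬6` of the first block. Its reduct is either absent or the
unsatisfiable empty rule, so `I` enters only through the membership of this one atom. -/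
theorem blockSat_iff {b k q : ℕ} {m : Mark} (h0 : m = .start → b = 9 * q)
    (h1 : m ≠ .start → b + 9 = 9 * q) (I J : Set ℕ) :
    (∀ t ∈ templates m, (∀ x ∈ t.neg, addr b k x ∉ I) →
      (∃ x ∈ t.head, addr b k x ∈ J) ∨ ∃ x ∈ t.pos, addr b k x ∉ J) ↔
      (m = .start → b + 6 ∈ I) ∧
        BlockSat (fun s => 9 * q + s ∈ J) (fun s => b + s ∈ J) (fun s => k + s ∈ J) m := by
  have h2 (s : ℕ) (h : m ≠ .start) : b + (9 + s) = 9 * q + s := by have := h1 h; omega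
  have e {α : Type} (P : α → Prop) (x : α) (l : List α) :
      (∃ y ∈ x :: l, P y) ↔ P x ∨ ∃ y ∈ l, P y := by simp
  rcases m with _ | _ | b' | (_ | b') | _
  · simp only [templates, commonTemplates, List.cons_append, List.nil_append,
      List.forall_mem_cons, e, List.not_mem_nil, IsEmpty.forall_iff, implies_true, and_true,
      forall_true_left, false_and, exists_false, or_false, addr, cond_true]
    rw [and_comm (b := BlockSat ..)]
    simp only [BlockSat, CommonSat, ← h0 rfl, imp_iff_or_not, not_not, and_assoc, false_or]
  all_goals
    simp only [ne_eq, reduceCtorEq, not_false_eq_true, forall_true_left] at h2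
    simp only [templates, commonTemplates, linkTemplates, List.cons_append, List.nil_append,
      List.forall_mem_cons, e, List.not_mem_nil, IsEmpty.forall_iff, implies_true, and_true,
      forall_true_left, false_and, exists_false, or_false, false_or, addr, cond_true, cond_false,
      h2, reduceCtorEq, true_and, BlockSat, CommonSat]
    simp only [imp_iff_or_not, iff_def, and_assoc, or_assoc]

theorem Layout.isModel_reduct_iff {p : ℕ} {chr : ℕ → Mark} {Q : ℕ} (hL : Layout p chr)
    (hQ : 0 < Q) (I J : Set ℕ) : IsModel ((blockProgram p chr Q).reduct I) J ↔
      6 ∈ I ∧ ∀ q < Q, BlockSat (fun s => 9 * q + s ∈ J) (fun s => 9 * (q - 1) + s ∈ J)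
        (fun s => 9 * (q - p) + s ∈ J) (chr q) := by
  have key (q : ℕ) := blockSat_iff (b := 9 * (q - 1)) (k := 9 * (q - p)) (q := q) (m := chr q)
    (fun h => by rw [(hL.start_iff q).1 h]) (fun h => by
      have := mt (hL.start_iff q).2 h
      omega) I J
  have h1 : IsModel ((blockProgram p chr Q).reduct I) J ↔
      ∀ q < Q, ∀ t ∈ templates (chr q), (∀ x ∈ t.neg, addr (9 * (q - 1)) (9 * (q - p)) x ∉ I) →
        (∃ x ∈ t.head, addr (9 * (q - 1)) (9 * (q - p)) x ∈ J) ∨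
          ∃ x ∈ t.pos, addr (9 * (q - 1)) (9 * (q - p)) x ∉ J := by
    have h2 {q : ℕ} {t : Template} (ht : t ∈ templates (chr q)) :
        ((t.toRule (9 * (q - 1)) (9 * (q - p))).dropNeg.Satisfies J ↔
          (∃ x ∈ t.head, addr (9 * (q - 1)) (9 * (q - p)) x ∈ J) ∨
            ∃ x ∈ t.pos, addr (9 * (q - 1)) (9 * (q - p)) x ∉ J) := by
      have h3 := Template.toRule_pos (wellFormed_of_mem ht) (hL.fits ht)
      simp [Rule.Satisfies, Rule.dropNeg, h3, Template.toRule_head, -Prod.exists]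
    have h4 {q : ℕ} {t : Template} (ht : t ∈ templates (chr q)) :
        (∀ a ∈ (t.toRule (9 * (q - 1)) (9 * (q - p))).neg, a ∉ I) ↔
          ∀ x ∈ t.neg, addr (9 * (q - 1)) (9 * (q - p)) x ∉ I := by
      have h3 := Template.toRule_neg (wellFormed_of_mem ht) (hL.fits ht)
      simp [h3, -Prod.forall, -Prod.exists]
    constructor
    · intro h q hq t ht hneg
      exact (h2 ht).1 (h _ ⟨_, mem_blockProgram.2 ⟨q, hq, t, ht, rfl⟩, (h4 ht).2 hneg, rfl⟩)
    · rintro h r ⟨s, hs, hneg, rfl⟩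
      obtain ⟨q, hq, t, ht, rfl⟩ := mem_blockProgram.1 hs
      exact (h2 ht).2 (h q hq t ht ((h4 ht).1 hneg))
  rw [h1]
  simp only [key]
  constructor
  · intro h
    exact ⟨by simpa using (h 0 hQ).1 ((hL.start_iff 0).2 rfl), fun q hq => (h q hq).2⟩
  · rintro ⟨h, h'⟩ q hq
    exact ⟨fun hs => by rw [(hL.start_iff q).1 hs]; simpa using h, h' q hq⟩

/-! ### The program of a sequence of tokens -/

/-- The marks of the blocks: after `L + 1` blocks for the index, every token has `L` blocks for the
bits of its variable and one for its kind. -/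
def tokenMark (L : ℕ) (ts : List Token) (q : ℕ) : Mark :=
  if q = 0 then .start
  else if q ≤ L then .init
  else if q = (L + 1) * (ts.length + 1) then .fin
  else if q % (L + 1) < L then
    .bit ((ts.getD (q / (L + 1) - 1) (0, none)).1.testBit (q % (L + 1)))
  else .tag (ts.getD (q / (L + 1) - 1) (0, none)).2

/-- The number of blocks. -/
def numBlocks (L : ℕ) (ts : List Token) : ℕ := (L + 1) * (ts.length + 1) + 1

/-- The program of a sequence of tokens. -/
noncomputable def tokenProgram (L : ℕ) (ts : List Token) : Program ℕ :=
  blockProgram (L + 1) (tokenMark L ts) (numBlocks L ts)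

theorem layout_tokenMark {L : ℕ} (hL : 1 ≤ L) (ts : List Token) :
    Layout (L + 1) (tokenMark L ts) where
  two_le := by omega
  start_iff q := by
    unfold tokenMark
    split_ifs with h <;> simp [h]
  le_of_usesBack q := by
    unfold tokenMark
    split_ifs with h1 h2 <;> simp only [Mark.UsesBack, false_implies] <;> omega

section positions
variable {L : ℕ} {ts : List Token}

theorem tokenMark_zero : tokenMark L ts 0 = .start := rfl

theorem tokenMark_init {q : ℕ} (h1 : 1 ≤ q) (h2 : q ≤ L) : tokenMark L ts q = .init := by
  rw [tokenMark, if_neg (by omega), if_pos h2]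

theorem tokenMark_fin (hL : 1 ≤ L) :
    tokenMark L ts ((L + 1) * (ts.length + 1)) = .fin := by
  have : L + 1 ≤ (L + 1) * (ts.length + 1) := Nat.le_mul_of_pos_right _ (by omega)
  rw [tokenMark, if_neg (by omega), if_neg (by omega), if_pos rfl]

theorem pos_div {j : ℕ} (k : ℕ) (hj : j ≤ L) : ((L + 1) * (k + 1) + j) / (L + 1) = k + 1 := by
  rw [Nat.mul_add_div (by omega), Nat.div_eq_of_lt (by omega), add_zero]

theorem pos_mod {j : ℕ} (k : ℕ) (hj : j ≤ L) : ((L + 1) * (k + 1) + j) % (L + 1) = j := by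
  rw [Nat.mul_add_mod, Nat.mod_eq_of_lt (by omega)]

theorem pos_lt {j k : ℕ} (hk : k < ts.length) (hj : j ≤ L) :
    (L + 1) * (k + 1) + j < (L + 1) * (ts.length + 1) := by
  have : (L + 1) * (k + 1 + 1) ≤ (L + 1) * (ts.length + 1) := Nat.mul_le_mul_left _ (by omega)
  have : (L + 1) * (k + 1 + 1) = (L + 1) * (k + 1) + (L + 1) := by ring
  omega

theorem lt_pos (k j : ℕ) : L < (L + 1) * (k + 1) + j := by
  have : L + 1 ≤ (L + 1) * (k + 1) := Nat.le_mul_of_pos_right _ (by omega)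
  omega

theorem tokenMark_bit {j k : ℕ} (hk : k < ts.length) (hj : j < L) :
    tokenMark L ts ((L + 1) * (k + 1) + j) = .bit ((ts.getD k (0, none)).1.testBit j) := by
  have h1 := pos_lt hk hj.le
  have h2 := lt_pos (L := L) k j
  rw [tokenMark, if_neg (by omega), if_neg (by omega), if_neg (by omega), pos_mod k hj.le,
    if_pos hj, pos_div k hj.le, Nat.add_sub_cancel]

theorem tokenMark_tag {k : ℕ} (hk : k < ts.length) :
    tokenMark L ts ((L + 1) * (k + 1) + L) = .tag (ts.getD k (0, none)).2 := by
  have h1 := pos_lt hk (le_refl L)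
  have h2 := lt_pos (L := L) k L
  rw [tokenMark, if_neg (by omega), if_neg (by omega), if_neg (by omega), pos_mod k le_rfl,
    if_neg (lt_irrefl _), pos_div k le_rfl, Nat.add_sub_cancel]

/-- The kinds of positions. -/
theorem position_cases {q : ℕ} (hq : q < numBlocks L ts) :
    q = 0 ∨ (1 ≤ q ∧ q ≤ L) ∨
      (∃ k < ts.length, ∃ j < L, q = (L + 1) * (k + 1) + j) ∨
      (∃ k < ts.length, q = (L + 1) * (k + 1) + L) ∨ q = (L + 1) * (ts.length + 1) := by
  unfold numBlocks at hq
  by_cases h1 : q ≤ L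
  · omega
  by_cases h2 : q = (L + 1) * (ts.length + 1)
  · simp [h2]
  have h3 := Nat.div_add_mod q (L + 1)
  have h4 : q / (L + 1) < ts.length + 1 := Nat.div_lt_of_lt_mul (by omega)
  have h5 : 1 ≤ q / (L + 1) := (Nat.one_le_div_iff (by omega)).2 (by omega)
  have h6 : q % (L + 1) < L + 1 := Nat.mod_lt _ (by omega)
  obtain ⟨k, hk⟩ := Nat.exists_eq_add_of_le' h5
  rw [hk] at h3 h4
  rcases Nat.lt_succ_iff_lt_or_eq.1 h6 with h7 | h7
  · exact .inr (.inr (.inl ⟨k, by omega, _, h7, h3.symm⟩))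
  · refine .inr (.inr (.inr (.inl ⟨k, by omega, ?_⟩)))
    omega

/-- The number of tokens that end at the block `q` or before. -/
def ended (L q : ℕ) : ℕ := (q + 1) / (L + 1) - 1

theorem ended_of_le {q : ℕ} (h : q ≤ L) : ended L q = 0 := by
  have : (q + 1) / (L + 1) ≤ 1 := by
    calc (q + 1) / (L + 1) ≤ (L + 1) / (L + 1) := Nat.div_le_div_right (by omega)
      _ = 1 := Nat.div_self (by omega)
  unfold ended
  omega

theorem ended_bit {j : ℕ} (k : ℕ) (hj : j < L) : ended L ((L + 1) * (k + 1) + j) = k := by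
  rw [ended, add_assoc, pos_div k (by omega), Nat.add_sub_cancel]

/-- The tag block is the last of its period, so the `q + 1` in `ended` counts the token from this
block on. The subtracted `1` stands for the initial period, which holds the index. -/
theorem ended_tag (k : ℕ) : ended L ((L + 1) * (k + 1) + L) = k + 1 := by
  rw [ended, show (L + 1) * (k + 1) + L + 1 = (L + 1) * (k + 1 + 1) by ring,
    Nat.mul_div_cancel_left _ (by omega), Nat.add_sub_cancel]

theorem ended_pred {j : ℕ} (k : ℕ) (hj : j ≤ L) : ended L ((L + 1) * (k + 1) + j - 1) = k := by
  have := lt_pos (L := L) k j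
  rw [ended, Nat.sub_add_cancel (by omega), pos_div k hj, Nat.add_sub_cancel]

end positions

/-! ### Satisfying assignments and answer sets -/

/-- The set of the atoms with the given truth values in the first `Q` blocks. -/
def blockSet (Q : ℕ) (R : ℕ → ℕ → Prop) : Set ℕ := {a | a / 9 < Q ∧ R (a / 9) (a % 9)}

theorem mem_blockSet {Q q s : ℕ} {R : ℕ → ℕ → Prop} (hs : s < 9) :
    9 * q + s ∈ blockSet Q R ↔ q < Q ∧ R q s := by
  rw [blockSet, Set.mem_ofPred_eq, show (9 * q + s) / 9 = q by omega,
    show (9 * q + s) % 9 = s by omega]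

theorem BlockSat.commonSat {c r k : ℕ → Prop} {m : Mark} (h : BlockSat c r k m) : CommonSat c := by
  rcases m with _ | _ | b' | (_ | b') | _ <;> exact h.1

theorem BlockSat.link {c r k : ℕ → Prop} {m : Mark} (h : BlockSat c r k m) (hm : m ≠ .start) :
    c 6 ↔ r 6 := by
  rcases m with _ | _ | b' | (_ | b') | _
  · exact absurd rfl hm
  all_goals exact h.2.1

/-- `J` satisfies the rules without negation of the program of `ts`. -/
def TokenModel (L : ℕ) (ts : List Token) (J : Set ℕ) : Prop :=
  ∀ q < numBlocks L ts, BlockSat (fun s => 9 * q + s ∈ J) (fun s => 9 * (q - 1) + s ∈ J)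
    (fun s => 9 * (q - (L + 1)) + s ∈ J) (tokenMark L ts q)

theorem isModel_reduct_tokenProgram_iff {L : ℕ} (hL : 1 ≤ L) {ts : List Token} {I J : Set ℕ} :
    IsModel ((tokenProgram L ts).reduct I) J ↔ 6 ∈ I ∧ TokenModel L ts J :=
  (layout_tokenMark hL ts).isModel_reduct_iff (Nat.succ_pos _) I J

/-! ### What the rules force in every model -/

namespace TokenModel
variable {L : ℕ} {ts : List Token} {J : Set ℕ}

theorem bit_lt {k j : ℕ} (hk : k < ts.length) (hj : j ≤ L) :
    (L + 1) * (k + 1) + j < numBlocks L ts := (pos_lt hk hj).trans (Nat.lt_succ_self _)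

theorem init_lt {q : ℕ} (hq : q ≤ L) : q < numBlocks L ts := by
  have : L + 1 ≤ (L + 1) * (ts.length + 1) := Nat.le_mul_of_pos_right _ (by omega)
  unfold numBlocks
  omega

theorem link (hL : 1 ≤ L) (hJ : TokenModel L ts J) {q : ℕ} (hq : q + 1 < numBlocks L ts) :
    9 * (q + 1) + 6 ∈ J ↔ 9 * q + 6 ∈ J :=
  (hJ _ hq).link (mt ((layout_tokenMark hL ts).start_iff _).1 (by omega))

theorem saturated_iff (hL : 1 ≤ L) (hJ : TokenModel L ts J) :
    ∀ {q : ℕ}, q < numBlocks L ts → (9 * q + 6 ∈ J ↔ 6 ∈ J)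
  | 0, _ => Iff.rfl
  | q + 1, hq => (hJ.link hL hq).trans (saturated_iff hL hJ (by omega))

theorem bit (hJ : TokenModel L ts J) {k j : ℕ} (hk : k < ts.length) (hj : j < L) :
    BlockSat (fun s => 9 * ((L + 1) * (k + 1) + j) + s ∈ J)
      (fun s => 9 * ((L + 1) * (k + 1) + j - 1) + s ∈ J)
      (fun s => 9 * ((L + 1) * k + j) + s ∈ J) (.bit ((ts.getD k (0, none)).1.testBit j)) := by
  have h := hJ _ (bit_lt hk hj.le)
  rwa [tokenMark_bit hk hj, show (L + 1) * (k + 1) + j - (L + 1) = (L + 1) * k + j by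
    rw [mul_add, mul_one]; omega] at h

theorem tag (hJ : TokenModel L ts J) {k : ℕ} (hk : k < ts.length) :
    BlockSat (fun s => 9 * ((L + 1) * (k + 1) + L) + s ∈ J)
      (fun s => 9 * ((L + 1) * (k + 1) + L - 1) + s ∈ J)
      (fun s => 9 * ((L + 1) * (k + 1) + L - (L + 1)) + s ∈ J)
      (.tag (ts.getD k (0, none)).2) := by
  have h := hJ _ (bit_lt hk le_rfl)
  rwa [tokenMark_tag hk] at h

theorem fin (hL : 1 ≤ L) (hJ : TokenModel L ts J) :
    BlockSat (fun s => 9 * ((L + 1) * (ts.length + 1)) + s ∈ J)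
      (fun s => 9 * ((L + 1) * (ts.length + 1) - 1) + s ∈ J)
      (fun s => 9 * ((L + 1) * (ts.length + 1) - (L + 1)) + s ∈ J) .fin := by
  have h := hJ ((L + 1) * (ts.length + 1)) (Nat.lt_succ_self _)
  rwa [tokenMark_fin hL] at h

theorem start (hJ : TokenModel L ts J) :
    BlockSat (fun s => 9 * 0 + s ∈ J) (fun s => 9 * 0 + s ∈ J) (fun s => 9 * (0 - (L + 1)) + s ∈ J)
      .start :=
  hJ 0 (Nat.succ_pos _)

theorem init (hJ : TokenModel L ts J) {q : ℕ} (h1 : 1 ≤ q) (h2 : q ≤ L) :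
    BlockSat (fun s => 9 * q + s ∈ J) (fun s => 9 * (q - 1) + s ∈ J)
      (fun s => 9 * (q - (L + 1)) + s ∈ J) .init := by
  have h := hJ q (init_lt h2)
  rwa [tokenMark_init h1 h2] at h

/-- The value of an atom that is kept from block to block, except possibly at the ends of tokens. -/
theorem induction_blocks {R : ℕ → Prop} (h0 : R 0)
    (hinit : ∀ q, 1 ≤ q → q ≤ L → R (q - 1) → R q)
    (hbit : ∀ k < ts.length, ∀ j < L, R ((L + 1) * (k + 1) + j - 1) → R ((L + 1) * (k + 1) + j))
    (htag : ∀ k < ts.length, R ((L + 1) * (k + 1) + L - 1) → R ((L + 1) * (k + 1) + L))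
    (hfin : R ((L + 1) * (ts.length + 1) - 1) → R ((L + 1) * (ts.length + 1))) :
    ∀ q < numBlocks L ts, R q := by
  intro q
  induction q with
  | zero => exact fun _ => h0
  | succ q ih =>
    intro hq
    have h := ih (by omega)
    rcases position_cases hq with h' | h' | ⟨k, hk, j, hj, h'⟩ | ⟨k, hk, h'⟩ | h'
    · omega
    · exact hinit _ h'.1 h'.2 h
    · rw [h']; exact hbit k hk j hj (by rwa [← h'])
    · rw [h']; exact htag k hk (by rwa [← h'])
    · rw [h']; exact hfin (by rwa [← h'])

/-- The index bits are the same for all tokens. -/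
theorem index_bit (hJ : TokenModel L ts J) {j : ℕ} (hj : j < L) {s : ℕ} (hs : s = 0 ∨ s = 1)
    (h : 9 * j + s ∈ J) : ∀ k ≤ ts.length, 9 * ((L + 1) * k + j) + s ∈ J
  | 0, _ => by simpa using h
  | k + 1, hk => by
    have ih := index_bit hJ hj hs h k (by omega)
    have hb := hJ.bit (k := k) (by omega) hj
    rcases hs with rfl | rfl
    · exact hb.2.2.1 ih
    · exact hb.2.2.2.1 ih

/-- A mismatch of a token and the index is noticed. -/
theorem mismatch (hJ : TokenModel L ts J) {k j : ℕ} (hk : k < ts.length) (hj : j < L)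
    (h : 9 * j + (if (ts.getD k (0, none)).1.testBit j then 1 else 0) ∈ J) :
    9 * ((L + 1) * (k + 1) + L - 1) + 2 ∈ J := by
  have h1 : 9 * ((L + 1) * (k + 1) + j) + 2 ∈ J := by
    refine (hJ.bit hk hj).2.2.2.2.2.1 (hJ.index_bit hj ?_ h (k + 1) (by omega))
    split_ifs <;> simp
  -- The mismatch is carried through the remaining bit blocks; the last of them directly precedes
  -- the tag block.
  have h2 (i : ℕ) (hi : j + i < L) : 9 * ((L + 1) * (k + 1) + (j + i)) + 2 ∈ J := by
    induction i with
    | zero => exact h1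
    | succ i ih => exact (hJ.bit hk hi).2.2.2.2.1 (ih (by omega))
  have h3 := h2 (L - 1 - j) (by omega)
  rwa [show j + (L - 1 - j) = L - 1 by omega, ← Nat.add_sub_assoc (by omega)] at h3

/-- Tokens without a mismatch have the same variable. -/
theorem eq_of_match (hJ : TokenModel L ts J) {k k' : ℕ} (hk : k < ts.length)
    (hk' : k' < ts.length) (hlt : (ts.getD k (0, none)).1 < 2 ^ L)
    (hlt' : (ts.getD k' (0, none)).1 < 2 ^ L)
    (h : 9 * ((L + 1) * (k + 1) + L - 1) + 2 ∉ J) (h' : 9 * ((L + 1) * (k' + 1) + L - 1) + 2 ∉ J) :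
    (ts.getD k (0, none)).1 = (ts.getD k' (0, none)).1 := by
  refine Nat.eq_of_testBit_eq fun j => ?_
  by_cases hj : j < L
  · have hor : 9 * j + 0 ∈ J ∨ 9 * j + 1 ∈ J := by
      rcases Nat.eq_zero_or_pos j with rfl | hj0
      · exact hJ.start.2.1
      · exact (hJ.init hj0 hj.le).2.2.1
    have h1 := mt (hJ.mismatch hk hj) h
    have h2 := mt (hJ.mismatch hk' hj) h'
    by_contra hne
    cases hb : (ts.getD k (0, none)).1.testBit j <;>
      cases hb' : (ts.getD k' (0, none)).1.testBit j <;>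
      simp only [hb, hb', if_true, if_false, Bool.false_eq_true, not_true_eq_false] at h1 h2 hne <;>
      tauto
  · have hle : 2 ^ L ≤ 2 ^ j := Nat.pow_le_pow_right (by norm_num) (by omega)
    rw [Nat.testBit_lt_two_pow (hlt.trans_le hle), Nat.testBit_lt_two_pow (hlt'.trans_le hle)]

/-- If all literals of the indexed variable have the guessed value `b`, then the atoms saturate. -/
theorem saturated_of_forall (hL : 1 ≤ L) (hJ : TokenModel L ts J) (b : Bool)
    (h : ∀ k < ts.length, (ts.getD k (0, none)).2 ≠ none →
      9 * ((L + 1) * (k + 1) + L - 1) + 2 ∉ J →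
        9 * ((L + 1) * (k + 1) + L) + (if b then 7 else 8) ∈ J) : 6 ∈ J := by
  -- The atom `3` belongs to the value true and `4` to false. It holds at the start and passes each
  -- literal either because of a mismatch or because of the guess; in the last block it triggers
  -- saturation.
  have hn : ∀ q < numBlocks L ts, 9 * q + (if b then 3 else 4) ∈ J := by
    refine induction_blocks ?_ (fun q h1 h2 => ?_) (fun k hk j hj => ?_) (fun k hk => ?_) ?_
    · have := hJ.start
      cases b
      exacts [this.2.2.2.1, this.2.2.1]
    · have := hJ.init h1 h2
      cases b
      exacts [this.2.2.2.2.1, this.2.2.2.1]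
    · have := hJ.bit hk hj
      cases b
      exacts [this.2.2.2.2.2.2.2.1, this.2.2.2.2.2.2.1]
    · intro hr
      have ht := hJ.tag hk
      have h1 := h k hk
      rcases hc : (ts.getD k (0, none)).2 with _ | s <;> rw [hc] at ht h1
      · cases b
        exacts [ht.2.2.2.2.2.1 hr, ht.2.2.2.2.1 hr]
      · by_cases h2 : 9 * ((L + 1) * (k + 1) + L - 1) + 2 ∈ J
        · cases b
          exacts [ht.2.2.2.2.2.2.1 hr h2, ht.2.2.2.2.1 hr h2]
        · have h3 := h1 (by simp) h2
          cases b
          exacts [ht.2.2.2.2.2.2.2.1 h3 hr, ht.2.2.2.2.2.1 h3 hr]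
    · have := hJ.fin hL
      cases b
      exacts [this.2.2.2.1, this.2.2.1]
  have h1 := hn ((L + 1) * (ts.length + 1)) (Nat.lt_succ_self _)
  refine (hJ.saturated_iff hL (Nat.lt_succ_self _)).1 ?_
  have := hJ.fin hL
  cases b
  exacts [this.2.2.2.2.2.2 h1, this.2.2.2.2.2.1 h1]

/-- Clauses whose literals are falsified are noticed. -/
theorem falsified_mem (hL : 1 ≤ L) (hJ : TokenModel L ts J) (σ : ℕ → Bool)
    (h : ∀ k < ts.length, ∀ b, (ts.getD k (0, none)).2 = some b → σ (ts.getD k (0, none)).1 ≠ b →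
      9 * ((L + 1) * (k + 1) + L) + (if b then 8 else 7) ∈ J) :
    ∀ q < numBlocks L ts, (ts.take (ended L q)).foldl (falsifyStep σ) true = true →
      9 * q + 5 ∈ J := by
  refine induction_blocks (fun _ => hJ.start.2.2.2.2) (fun q h1 h2 ih hf => ?_)
    (fun k hk j hj ih hf => ?_) (fun k hk ih hf => ?_) fun ih hf => ?_
  · refine (hJ.init h1 h2).2.2.2.2.2 (ih ?_)
    rwa [ended_of_le (by omega), ← ended_of_le h2]
  · refine (hJ.bit hk hj).2.2.2.2.2.2.2.2 (ih ?_)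
    rwa [ended_pred k hj.le, ← ended_bit k hj]
  · rw [ended_pred k le_rfl] at ih
    rw [ended_tag, ← List.take_concat_get' _ _ hk, List.foldl_append] at hf
    have ht := hJ.tag hk
    have h1 := h k hk
    rw [List.getD_eq_getElem _ _ hk] at ht h1
    rcases hc : ts[k].2 with _ | b <;> rw [hc] at ht h1
    -- At the end of a clause the atom `5` is a fact: the next clause starts with no literal read.
    · exact ht.2.2.2.2.2.2.1
    · simp only [List.foldl_cons, List.foldl_nil, falsifyStep, hc, Option.elim, Bool.and_eq_true,
        bne_iff_ne] at hf
      exact ht.2.2.2.2.2.2.2.2 (h1 b rfl hf.2) (ih hf.1)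
  · refine (hJ.fin hL).2.2.2.2.1 (ih ?_)
    -- The last block stands where a token with the number `ts.length` would begin.
    have h1 := ended_pred (L := L) (j := 0) ts.length (by omega)
    have h2 := ended_bit (L := L) (j := 0) ts.length (by omega)
    rw [add_zero] at h1 h2
    rwa [h1, ← h2]

end TokenModel

/-! ### Models given by truth values, and the equivalence with satisfiability -/

section
variable {L : ℕ} {ts : List Token}

/-- To be a model of the program of `ts`, in terms of truth values. -/
theorem tokenModel_blockSet (hL : 1 ≤ L) {R : ℕ → ℕ → Prop}
    (hc : ∀ q < numBlocks L ts, CommonSat (R q))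
    (hlink : ∀ q, R (q + 1) 6 ↔ R q 6)
    (hstart : (R 0 0 ∨ R 0 1) ∧ R 0 3 ∧ R 0 4 ∧ R 0 5)
    (hinit : ∀ q, 1 ≤ q → q ≤ L → (R q 0 ∨ R q 1) ∧ (R (q - 1) 3 → R q 3) ∧
      (R (q - 1) 4 → R q 4) ∧ (R (q - 1) 5 → R q 5))
    (hback : ∀ q, L + 1 ≤ q → (R (q - (L + 1)) 0 → R q 0) ∧ (R (q - (L + 1)) 1 → R q 1))
    (hbit : ∀ k < ts.length, ∀ j < L, ∀ q, q = (L + 1) * (k + 1) + j →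
      (R (q - 1) 2 → R q 2) ∧
      (R q (if (ts.getD k (0, none)).1.testBit j then 1 else 0) → R q 2) ∧
      (R (q - 1) 3 → R q 3) ∧ (R (q - 1) 4 → R q 4) ∧ (R (q - 1) 5 → R q 5))
    (hlit : ∀ k < ts.length, ∀ b, (ts.getD k (0, none)).2 = some b →
      ∀ q, q = (L + 1) * (k + 1) + L → (R (q - 1) 3 → R (q - 1) 2 → R q 3) ∧
      (R q 7 → R (q - 1) 3 → R q 3) ∧ (R (q - 1) 4 → R (q - 1) 2 → R q 4) ∧
      (R q 8 → R (q - 1) 4 → R q 4) ∧ (R q (if b then 8 else 7) → R (q - 1) 5 → R q 5))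
    (hsep : ∀ k < ts.length, (ts.getD k (0, none)).2 = none →
      ∀ q, q = (L + 1) * (k + 1) + L → (R (q - 1) 3 → R q 3) ∧ (R (q - 1) 4 → R q 4) ∧ R q 5 ∧
      ¬ R (q - 1) 5)
    (hfin : ∀ q, q = (L + 1) * (ts.length + 1) → (R (q - 1) 3 → R q 3) ∧ (R (q - 1) 4 → R q 4) ∧
      (R (q - 1) 5 → R q 5) ∧ (R q 3 → R q 6) ∧ (R q 4 → R q 6)) :
    TokenModel L ts (blockSet (numBlocks L ts) R) := by
  intro q hq
  have hq1 : q - 1 < numBlocks L ts := by omega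
  have hq2 : q - (L + 1) < numBlocks L ts := by omega
  have h6 (h : 1 ≤ q) : R q 6 ↔ R (q - 1) 6 := by
    have := hlink (q - 1)
    rwa [Nat.sub_add_cancel h] at this
  have hcq := hc q hq
  rcases position_cases hq with rfl | h | ⟨k, hk, j, hj, h⟩ | ⟨k, hk, h⟩ | h
  · simpa only [tokenMark_zero, BlockSat, CommonSat, mem_blockSet, Nat.reduceLT, hq, true_and]
      using ⟨hcq, hstart⟩
  · have h' := hinit q h.1 h.2
    simp only [tokenMark_init h.1 h.2, BlockSat, CommonSat, mem_blockSet, Nat.reduceLT, hq, hq1,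
      true_and]
    exact ⟨hcq, h6 h.1, h'⟩
  · have h1 := lt_pos (L := L) k j
    have h' := hbit k hk j hj q h
    have hb := hback q (by omega)
    have hm := tokenMark_bit hk hj
    rw [← h] at hm
    rw [hm]
    cases hbj : (ts.getD k (0, none)).1.testBit j <;>
      simp only [hbj, if_true, if_false, Bool.false_eq_true] at h' <;>
      simp only [BlockSat, CommonSat, mem_blockSet, Nat.reduceLT, hq, hq1, hq2, true_and, if_true,
        if_false, Bool.false_eq_true] <;>
      exact ⟨hcq, h6 (by omega), hb.1, hb.2, h'⟩
  · have h1 := lt_pos (L := L) k L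
    have hb := hback q (by omega)
    have hm := tokenMark_tag (L := L) hk
    rw [← h] at hm
    rw [hm]
    rcases ho : (ts.getD k (0, none)).2 with _ | b
    · have h' := hsep k hk ho q h
      simp only [BlockSat, CommonSat, mem_blockSet, Nat.reduceLT, hq, hq1, hq2, true_and]
      exact ⟨hcq, h6 (by omega), hb.1, hb.2, h'.1, h'.2.1, h'.2.2.1, fun _ => h'.2.2.2⟩
    · have h' := hlit k hk b ho q h
      cases b <;> simp only [if_true, if_false, Bool.false_eq_true] at h' <;>
        simp only [BlockSat, CommonSat, mem_blockSet, Nat.reduceLT, hq, hq1, hq2, true_and,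
          if_true, if_false, Bool.false_eq_true] <;>
        exact ⟨hcq, h6 (by omega), hb.1, hb.2, h'⟩
  · have h' := hfin q h
    have h1 : L + 1 ≤ (L + 1) * (ts.length + 1) := Nat.le_mul_of_pos_right _ (by omega)
    rw [h, tokenMark_fin hL, ← h]
    simp only [BlockSat, CommonSat, mem_blockSet, Nat.reduceLT, hq, hq1, true_and]
    exact ⟨hcq, h6 (by omega), h'⟩

theorem mem_blockSet_iff {Q a : ℕ} {R : ℕ → ℕ → Prop} :
    a ∈ blockSet Q R ↔ ∃ q < Q, ∃ s < 9, a = 9 * q + s ∧ R q s := by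
  constructor
  · rintro ⟨h1, h2⟩
    exact ⟨a / 9, h1, a % 9, Nat.mod_lt _ (by norm_num), by omega, h2⟩
  · rintro ⟨q, hq, s, hs, rfl, h⟩
    exact (mem_blockSet hs).2 ⟨hq, h⟩

/-- The variable of the token to which the block `q` belongs. -/
def blockVar (L : ℕ) (ts : List Token) (q : ℕ) : ℕ := (ts.getD (q / (L + 1) - 1) (0, none)).1

theorem blockVar_tag (k : ℕ) :
    blockVar L ts ((L + 1) * (k + 1) + L) = (ts.getD k (0, none)).1 := by
  rw [blockVar, pos_div k le_rfl, Nat.add_sub_cancel]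

/-- The truth values of the answer set of a satisfying assignment. -/
def assignmentRel (σ : ℕ → Bool) (L : ℕ) (ts : List Token) (q : ℕ) : ℕ → Prop
  | 5 => (ts.take (ended L q)).foldl (falsifyStep σ) true = true
  | 7 => σ (blockVar L ts q) = true
  | 8 => σ (blockVar L ts q) = false
  | _ => True

/-- In a saturated set only the guesses and the falsification flag need attention, and the
constraint at the end of a clause is what `NoneFalsified` provides. -/
theorem tokenModel_assignment (hL : 1 ≤ L) {σ : ℕ → Bool} (hσ : NoneFalsified σ true ts) :
    TokenModel L ts (blockSet (numBlocks L ts) (assignmentRel σ L ts)) := by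
  refine tokenModel_blockSet hL ?_ ?_ ?_ ?_ ?_ ?_ ?_ ?_ ?_
  · intro q _
    simp only [CommonSat, assignmentRel]
    simp
  · simp [assignmentRel]
  · simp [assignmentRel, ended_of_le (Nat.zero_le L)]
  · intro q h1 h2
    simp [assignmentRel, ended_of_le h2]
  · simp [assignmentRel]
  · rintro k hk j hj q rfl
    simp [assignmentRel, ended_bit k hj, ended_pred k hj.le]
  · rintro k hk b hb q rfl
    rw [List.getD_eq_getElem _ _ hk] at hb
    simp only [assignmentRel, ended_tag, ended_pred k le_rfl, ← List.take_concat_get' _ _ hk,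
      List.foldl_append, List.foldl_cons, List.foldl_nil, falsifyStep, hb, Option.elim,
      Bool.and_eq_true, bne_iff_ne]
    have hv := blockVar_tag (L := L) (ts := ts) k
    rw [List.getD_eq_getElem _ _ hk] at hv
    cases b <;> simp [hv] <;> tauto
  · rintro k hk hb q rfl
    have h1 := hσ k hk hb
    rw [List.getD_eq_getElem _ _ hk] at hb
    simp only [assignmentRel, ended_tag, ended_pred k le_rfl, ← List.take_concat_get' _ _ hk,
      List.foldl_append, List.foldl_cons, List.foldl_nil, falsifyStep, hb, Option.elim]
    simp [h1]
  · rintro q rfl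
    have h1 := ended_pred (L := L) (j := 0) ts.length (by omega)
    have h2 := ended_bit (L := L) (j := 0) ts.length (by omega)
    rw [add_zero] at h1 h2
    simp [assignmentRel, h1, h2]

/-- A satisfying assignment yields an answer set. -/
theorem isConsistent_of_noneFalsified (hL : 1 ≤ L)
    (hts : ∀ k < ts.length, (ts.getD k (0, none)).2 ≠ none → (ts.getD k (0, none)).1 < 2 ^ L)
    {σ : ℕ → Bool} (hσ : NoneFalsified σ true ts) : (tokenProgram L ts).IsConsistent := by
  set I := blockSet (numBlocks L ts) (assignmentRel σ L ts) with hI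
  have h6 : 6 ∈ I := (mem_blockSet (q := 0) (s := 6) (by norm_num)).2 ⟨Nat.succ_pos _, trivial⟩
  refine ⟨I, (isModel_reduct_tokenProgram_iff hL).2 ⟨h6, tokenModel_assignment hL hσ⟩, ?_⟩
  intro J hJ hJI
  replace hJ := ((isModel_reduct_tokenProgram_iff hL).1 hJ).2
  -- `I` has exactly one of the atoms `7`, `8` in each block, while the subset `J` still has to
  -- satisfy their disjunction. Hence `J` makes the same guesses.
  have hv {q : ℕ} (hq : q < numBlocks L ts) :
      9 * q + (if σ (blockVar L ts q) then 7 else 8) ∈ J := by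
    have h1 := (hJ q hq).commonSat.2.2.2.2.2
    have h2 (s : ℕ) (hs : s < 9) (h : 9 * q + s ∈ J) : assignmentRel σ L ts q s :=
      ((mem_blockSet hs).1 (hJI h)).2
    cases hb : σ (blockVar L ts q)
    · refine h1.resolve_left fun h => ?_
      have := h2 7 (by norm_num) h
      simp [assignmentRel, hb] at this
    · refine h1.resolve_right fun h => ?_
      have := h2 8 (by norm_num) h
      simp [assignmentRel, hb] at this
  -- All literals that match the index of `J` have one variable, hence one guess, and this forces
  -- saturation. If none matches, either value of `b` serves.
  have h6J : 6 ∈ J := by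
    by_cases hex : ∃ k < ts.length, (ts.getD k (0, none)).2 ≠ none ∧
        9 * ((L + 1) * (k + 1) + L - 1) + 2 ∉ J
    · obtain ⟨k₀, hk₀, hn₀, hm₀⟩ := hex
      refine hJ.saturated_of_forall hL (σ (ts.getD k₀ (0, none)).1) fun k hk hn hm => ?_
      have h1 := hv (TokenModel.bit_lt hk le_rfl)
      rwa [blockVar_tag, hJ.eq_of_match hk hk₀ (hts k hk hn) (hts k₀ hk₀ hn₀) hm hm₀] at h1
    · push Not at hex
      exact hJ.saturated_of_forall hL true fun k hk hn hm => absurd (hex k hk hn) hm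
  have hf := hJ.falsified_mem hL σ fun k hk b hb hne => by
    have h1 := hv (TokenModel.bit_lt hk le_rfl)
    rw [blockVar_tag] at h1
    cases b
    · rwa [if_pos (by simpa only [ne_eq, Bool.not_eq_false] using hne)] at h1
    · rwa [if_neg hne] at h1
  intro a ha
  obtain ⟨q, hq, s, hs, rfl, h⟩ := mem_blockSet_iff.1 ha
  obtain ⟨h0, h1, h2, h3, h4, h7⟩ := (hJ q hq).commonSat
  have hw := (hJ.saturated_iff hL hq).2 h6J
  have hvq := hv hq
  interval_cases s
  · exact h0 hw
  · exact h1 hw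
  · exact h2 hw
  · exact h3 hw
  · exact h4 hw
  · exact hf q hq h
  · exact hw
  · simp only [assignmentRel] at h
    simpa [h] using hvq
  · simp only [assignmentRel] at h
    simpa [h] using hvq

/-- The truth values of the model of the reduct for the index `i`. -/
def indexRel (I : Set ℕ) (i L : ℕ) (ts : List Token) (q : ℕ) : ℕ → Prop
  | 0 => i.testBit (q % (L + 1)) = true
  | 1 => i.testBit (q % (L + 1)) = false
  | 2 => L + 1 ≤ q ∧ q % (L + 1) < L ∧
      ∃ j ≤ q % (L + 1), (blockVar L ts q).testBit j ≠ i.testBit j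
  | 3 => ∀ k < ended L q, (ts.getD k (0, none)).2 ≠ none → (ts.getD k (0, none)).1 = i →
      9 * ((L + 1) * (k + 1) + L) + 7 ∈ I
  | 4 => ∀ k < ended L q, (ts.getD k (0, none)).2 ≠ none → (ts.getD k (0, none)).1 = i →
      9 * ((L + 1) * (k + 1) + L) + 8 ∈ I
  | 5 => 9 * q + 5 ∈ I
  | 6 => False
  | 7 => 9 * q + 7 ∈ I
  | 8 => 9 * q + 8 ∈ I
  | _ => False

/-- This model keeps the guesses of `I`, selects the index `i` and does not saturate. Of the two
given occurrences of the variable `i`, one refutes the atom `3` at the end and the other refutes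
`4`, so nothing forces the atom `6`. -/
theorem tokenModel_index (hL : 1 ≤ L) {I : Set ℕ} (hI : TokenModel L ts I) {i k k' : ℕ}
    (hk : k < ts.length) (hn : (ts.getD k (0, none)).2 ≠ none)
    (hi : (ts.getD k (0, none)).1 = i) (h7 : 9 * ((L + 1) * (k + 1) + L) + 7 ∉ I)
    (hk' : k' < ts.length) (hn' : (ts.getD k' (0, none)).2 ≠ none)
    (hi' : (ts.getD k' (0, none)).1 = i) (h8 : 9 * ((L + 1) * (k' + 1) + L) + 8 ∉ I) :
    TokenModel L ts (blockSet (numBlocks L ts) (indexRel I i L ts)) := by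
  refine tokenModel_blockSet hL ?_ ?_ ?_ ?_ ?_ ?_ ?_ ?_ ?_
  · intro q hq
    have := (hI q hq).commonSat.2.2.2.2.2
    simp only [CommonSat, indexRel]
    simpa using this
  · simp [indexRel]
  · have := hI.start.2.2.2.2
    simp only [indexRel, ended_of_le (Nat.zero_le L)]
    refine ⟨?_, ?_, ?_, this⟩
    · cases i.testBit (0 % (L + 1)) <;> simp
    · simp
    · simp
  · intro q h1 h2
    have := (hI.init h1 h2).2.2.2.2.2
    simp only [indexRel, ended_of_le h2]
    refine ⟨?_, ?_, ?_, this⟩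
    · cases i.testBit (q % (L + 1)) <;> simp
    · simp
    · simp
  · intro q hq
    have : (q - (L + 1)) % (L + 1) = q % (L + 1) := (Nat.mod_eq_sub_mod hq).symm
    simp [indexRel, this]
  · rintro m hm j hj q rfl
    have h5 := (hI.bit hm hj).2.2.2.2.2.2.2.2
    have hbv : blockVar L ts ((L + 1) * (m + 1) + j) = (ts.getD m (0, none)).1 := by
      rw [blockVar, pos_div m hj.le, Nat.add_sub_cancel]
    have hlt := lt_pos (L := L) m j
    simp only [indexRel, ended_bit m hj, ended_pred m hj.le, pos_mod m hj.le, hbv]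
    refine ⟨?_, ?_, id, id, h5⟩
    · rintro ⟨h1, h2, j', hj', hne⟩
      rcases Nat.eq_zero_or_pos j with rfl | hj0
      -- The block before the first bit of a token is at position `L` of its period, where `2` is
      -- false. So no mismatch leaks in from the preceding token.
      · rw [add_zero, show (L + 1) * (m + 1) - 1 = (L + 1) * m + L by rw [mul_add]; omega,
          Nat.mul_add_mod, Nat.mod_eq_of_lt (Nat.lt_succ_self L)] at h2
        omega
      · rw [Nat.add_sub_assoc hj0, pos_mod m (by omega)] at hj'
        rw [Nat.add_sub_assoc hj0, blockVar, pos_div m (by omega), Nat.add_sub_cancel] at hne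
        exact ⟨by omega, hj, j', by omega, hne⟩
    · intro h
      refine ⟨by omega, hj, j, le_rfl, ?_⟩
      cases hb : (ts.getD m (0, none)).1.testBit j <;>
        simp only [hb, if_true, if_false, Bool.false_eq_true] at h <;> simp [h]
  · rintro m hm b hb q rfl
    have h5 := (hI.tag hm)
    rw [hb] at h5
    -- A mismatch just before the tag block shows that the token has another variable, so it imposes
    -- no condition on the atoms `3` and `4`.
    have hmis : indexRel I i L ts ((L + 1) * (m + 1) + L - 1) 2 →
        (ts.getD m (0, none)).1 ≠ i := by
      rintro ⟨h1, h2, j, hj, hne⟩ rfl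
      rw [Nat.add_sub_assoc hL, blockVar, pos_div m (by omega), Nat.add_sub_cancel] at hne
      exact hne rfl
    have hsucc (P : ℕ → Prop) (h : ∀ k < m, P k) (h' : P m) : ∀ k < m + 1, P k := fun k hk => by
      rcases Nat.lt_succ_iff_lt_or_eq.1 hk with h'' | rfl
      exacts [h k h'', h']
    refine ⟨?_, ?_, ?_, ?_, ?_⟩
    · simp only [indexRel, ended_tag, ended_pred m le_rfl]
      exact fun h h' => hsucc _ h fun _ hi => absurd hi (hmis h')
    · simp only [indexRel, ended_tag, ended_pred m le_rfl]
      exact fun h' h => hsucc _ h fun _ _ => h'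
    · simp only [indexRel, ended_tag, ended_pred m le_rfl]
      exact fun h h' => hsucc _ h fun _ hi => absurd hi (hmis h')
    · simp only [indexRel, ended_tag, ended_pred m le_rfl]
      exact fun h' h => hsucc _ h fun _ _ => h'
    · cases b
      · exact h5.2.2.2.2.2.2.2.2
      · exact h5.2.2.2.2.2.2.2.2
  · rintro m hm hb q rfl
    have h5 := (hI.tag hm)
    rw [hb] at h5
    have hsucc (P : ℕ → Prop) (h : ∀ k < m, P k) (h' : P m) : ∀ k < m + 1, P k := fun k hk => by
      rcases Nat.lt_succ_iff_lt_or_eq.1 hk with h'' | rfl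
      exacts [h k h'', h']
    simp only [indexRel, ended_tag, ended_pred m le_rfl]
    exact ⟨fun h => hsucc _ h fun h' => absurd hb h', fun h => hsucc _ h fun h' => absurd hb h',
      h5.2.2.2.2.2.2.1, h5.2.2.2.2.2.2.2 h5.2.2.2.2.2.2.1⟩
  · rintro q rfl
    have h5 := (hI.fin hL).2.2.2.2.1
    have h1 := ended_pred (L := L) (j := 0) ts.length (by omega)
    have h2 := ended_bit (L := L) (j := 0) ts.length (by omega)
    rw [add_zero] at h1 h2
    simp only [indexRel, h1, h2]
    exact ⟨id, id, h5, fun h => h7 (h k hk hn hi), fun h => h8 (h k' hk' hn' hi')⟩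

/-- An answer set yields a satisfying assignment. -/
theorem noneFalsified_of_isConsistent (hL : 1 ≤ L) (h : (tokenProgram L ts).IsConsistent) :
    ∃ σ, NoneFalsified σ true ts := by
  classical
  obtain ⟨I, hI, hmin⟩ := h
  obtain ⟨h6, hI⟩ := (isModel_reduct_tokenProgram_iff hL).1 hI
  -- A variable is true iff none of its occurrences lacks the guess `7`. The converse link, that an
  -- occurrence of a false variable has the guess `8`, comes from minimality below.
  let σ : ℕ → Bool := fun i => decide (∀ k < ts.length, (ts.getD k (0, none)).2 ≠ none →
    (ts.getD k (0, none)).1 = i → 9 * ((L + 1) * (k + 1) + L) + 7 ∈ I)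
  have hf := hI.falsified_mem hL σ fun k hk b hb hne => by
    cases b
    · have h1 : σ (ts.getD k (0, none)).1 = true := by simpa using hne
      exact of_decide_eq_true h1 k hk (by rw [hb]; simp) rfl
    · have h1 : σ (ts.getD k (0, none)).1 = false := by simpa using hne
      have h2 := of_decide_eq_false h1
      push Not at h2
      obtain ⟨k', hk', hn', hi', h7⟩ := h2
      -- Otherwise one occurrence of the variable lacks `7` and another lacks `8`, and the
      -- unsaturated index model contradicts the minimality of `I`.
      by_contra h8
      have h3 := tokenModel_index hL hI hk' hn' hi' h7 hk (by rw [hb]; simp) rfl h8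
      -- `I` is saturated and so contains the atoms `0` to `4` of every block; the atoms `5`, `7`,
      -- `8` of the index model are copied from `I`.
      have h4 : blockSet (numBlocks L ts) (indexRel I (ts.getD k (0, none)).1 L ts) ⊆ I := by
        intro a ha
        obtain ⟨q, hq, s, hs, rfl, h⟩ := mem_blockSet_iff.1 ha
        obtain ⟨h0, h1, h2, h3, h4, -⟩ := (hI q hq).commonSat
        have hw := (hI.saturated_iff hL hq).2 h6
        interval_cases s
        exacts [h0 hw, h1 hw, h2 hw, h3 hw, h4 hw, h, hw, h, h]
      have h5 := hmin ((isModel_reduct_tokenProgram_iff hL).2 ⟨h6, h3⟩) h4 h6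
      exact ((mem_blockSet (q := 0) (s := 6) (by norm_num)).1 h5).2
  refine ⟨σ, fun k hk hn => ?_⟩
  by_contra hne
  have h1 := hf ((L + 1) * (k + 1) + L - 1) (by
    have := TokenModel.bit_lt (L := L) hk le_rfl
    omega) (by rwa [ended_pred k le_rfl, ← Bool.not_eq_false])
  have h2 := hI.tag hk
  rw [hn] at h2
  exact h2.2.2.2.2.2.2.2 h2.2.2.2.2.2.2.1 h1

end

/-- The program of a formula is consistent iff the formula is satisfiable. -/
theorem isConsistent_tokenProgram_iff {L : ℕ} (hL : 1 ≤ L) {F : CNF} {l : List Clause}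
    (hl : Lists l F) (hF : ∀ x ∈ F.vars, x < 2 ^ L) :
    (tokenProgram L (l.flatMap clauseTokens)).IsConsistent ↔ F.IsSatisfiable := by
  have hsat : F.IsSatisfiable ↔ ∃ σ, NoneFalsified σ true (l.flatMap clauseTokens) := by
    simp only [noneFalsified_iff, hl.2]
    rfl
  rw [hsat]
  refine ⟨noneFalsified_of_isConsistent hL, fun ⟨σ, hσ⟩ => isConsistent_of_noneFalsified hL ?_ hσ⟩
  intro k hk hn
  rw [List.getD_eq_getElem _ _ hk] at hn ⊢
  obtain ⟨C, hC, hmem⟩ := List.mem_flatMap.1 (List.getElem_mem hk)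
  refine hF _ (Finset.mem_biUnion.2 ⟨C, (hl.2 C).1 hC, ?_⟩)
  simp only [clauseTokens, List.mem_append, List.mem_map, Finset.mem_sort,
    List.mem_singleton] at hmem
  rcases hmem with ⟨a, ha, h⟩ | ⟨a, ha, h⟩ | h
  · rw [← h]; exact Finset.mem_union_left _ ha
  · rw [← h]; exact Finset.mem_union_right _ ha
  · exact absurd (by rw [h]) hn


/-! ### The machine that writes the program of a formula -/

/-- The stacks of the machine. -/
inductive Stk
  | inp
  | aux
  | out
  | tmp
  | lg
  | lgc
  | num
  | flag
  | base
  | back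
  deriving DecidableEq

instance : Fintype Stk :=
  ⟨{.inp, .aux, .out, .tmp, .lg, .lgc, .num, .flag, .base, .back}, by rintro (_ | _) <;> simp⟩

/-- The contents of the stacks, where `out` is the word written so far and the numbers are in
unary. -/
structure St where
  inp : List Symbol := []
  aux : List Symbol := []
  out : List Symbol := []
  tmp : ℕ := 0
  lg : ℕ := 0
  lgc : ℕ := 0
  num : ℕ := 0
  flag : ℕ := 0
  base : ℕ := 0
  back : ℕ := 0

/-- The stacks. -/
def St.stk (s : St) : Stk → List Symbol
  | .inp => s.inp
  | .aux => s.aux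
  | .out => s.out.reverse
  | .tmp => List.replicate s.tmp .tick
  | .lg => List.replicate s.lg .tick
  | .lgc => List.replicate s.lgc .tick
  | .num => List.replicate s.num .tick
  | .flag => List.replicate s.flag .tick
  | .base => List.replicate s.base .tick
  | .back => List.replicate s.back .tick

/-- The program `c` goes from `s` to `s'` in at most `T` steps. -/
def Runs (c : Cmd Stk Symbol) (s s' : St) (T : ℕ) : Prop := ∃ t ≤ T, c.Exec s.stk s'.stk t

namespace Runs
variable {c d : Cmd Stk Symbol} {s s' s₁ s₂ s₃ : St} {T T' : ℕ}

theorem mono (h : Runs c s s' T) (hT : T ≤ T') : Runs c s s' T' :=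
  let ⟨t, ht, h⟩ := h
  ⟨t, ht.trans hT, h⟩

theorem cast (h : Runs c s s₁ T) (hs : s₁ = s') (hT : T ≤ T') : Runs c s s' T' :=
  hs ▸ h.mono hT

theorem cast' (h : Runs c s s' T) (hc : c = d) : Runs d s s' T := hc ▸ h

theorem skip : Runs .skip s s 1 := ⟨1, le_rfl, .skip _⟩

theorem push {k : Stk} {x : Symbol} (h : s'.stk = Function.update s.stk k (x :: s.stk k)) :
    Runs (.push k x) s s' 1 := ⟨1, le_rfl, h ▸ .push k x _⟩

theorem seq (h : Runs c s₁ s₂ T) (h' : Runs d s₂ s₃ T') : Runs (.seq c d) s₁ s₃ (T + T') :=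
  let ⟨_, ht, h⟩ := h
  let ⟨_, ht', h'⟩ := h'
  ⟨_, Nat.add_le_add ht ht', h.seq h'⟩

theorem cases {k : Stk} {b : Option Symbol → Cmd Stk Symbol} {o : Option Symbol}
    (ho : (s₁.stk k).head? = o) (h : s₂.stk = Function.update s₁.stk k (s₁.stk k).tail)
    (h' : Runs (b o) s₂ s₃ T) : Runs (.cases k b) s₁ s₃ (T + 1) := by
  obtain ⟨t, ht, h'⟩ := h'
  rw [h, ← ho] at h'
  exact ⟨1 + t, by omega, .cases h'⟩

theorem loop_nil {k : Stk} {b : Symbol → Cmd Stk Symbol} (h : s.stk k = []) :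
    Runs (.loop k b) s s 1 := ⟨1, le_rfl, .loop_nil h⟩

theorem loop_cons {k : Stk} {b : Symbol → Cmd Stk Symbol} {x : Symbol} {xs : List Symbol} {s₄ : St}
    (hx : s₁.stk k = x :: xs) (h : s₂.stk = Function.update s₁.stk k xs)
    (h' : Runs (b x) s₂ s₃ T) (h'' : Runs (.loop k b) s₃ s₄ T') :
    Runs (.loop k b) s₁ s₄ (T + T' + 1) := by
  obtain ⟨t, ht, h'⟩ := h'
  obtain ⟨t', ht', h''⟩ := h''
  rw [h] at h'
  exact ⟨1 + (t + t'), by omega, .loop_cons hx h' h''⟩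

end Runs

/-- `n` symbols `x` are pushed. -/
def pushN (k : Stk) (x : Symbol) : ℕ → Cmd Stk Symbol
  | 0 => .skip
  | n + 1 => .seq (.push k x) (pushN k x n)

/-- The stack of a base address. -/
def baseStk (r : Bool) : Stk := bif r then .base else .back

/-- A base address is written. -/
def emitBase (r : Bool) : Cmd Stk Symbol :=
  .seq (.loop (baseStk r) fun _ => .seq (.push .tmp .tick) (.push .out .tick))
    (.loop .tmp fun _ => .push (baseStk r) .tick)

/-- Marked atoms are written. -/
def emitAtoms (tag : Symbol) : List (Bool × ℕ) → Cmd Stk Symbol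
  | [] => .skip
  | x :: l => .seq (.seq (emitBase x.1) (.seq (pushN .out .tick x.2) (.push .out tag)))
      (emitAtoms tag l)

/-- A sequence of rules is written. -/
def emitRules : List Template → Cmd Stk Symbol
  | [] => .skip
  | t :: l => .seq (.seq (emitAtoms .head t.head) (.seq (emitAtoms .pos t.pos)
      (.seq (emitAtoms .neg t.neg) (.push .out .sep)))) (emitRules l)

/-- The base addresses are increased. -/
def advance : Mark → Cmd Stk Symbol
  | .start => .skip
  | .init => pushN .base .tick 9
  | _ => .seq (pushN .base .tick 9) (pushN .back .tick 9)

/-- The rules of a block are written. -/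
def emitBlock (m : Mark) : Cmd Stk Symbol := .seq (emitRules (templates m)) (advance m)

/-! ### Writing rules and blocks in time linear in the addresses -/

section emit

theorem runs_pushN_out (x : Symbol) (n : ℕ) (s : St) :
    Runs (pushN .out x n) s { s with out := s.out ++ List.replicate n x } (n + 1) := by
  induction n generalizing s with
  | zero => exact Runs.cast .skip (by simp) le_rfl
  | succ n ih =>
    refine Runs.cast (Runs.seq (.push (s' := { s with out := s.out ++ [x] }) ?_) (ih _)) ?_ ?_
    · funext k; cases k <;> simp [St.stk]
    · simp [List.replicate_succ]
    · omega

theorem runs_pushN_base (n : ℕ) (s : St) :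
    Runs (pushN .base .tick n) s { s with base := s.base + n } (n + 1) := by
  induction n generalizing s with
  | zero => exact .skip
  | succ n ih =>
    refine Runs.cast (Runs.seq (.push (s' := { s with base := s.base + 1 }) ?_) (ih _)) ?_ ?_
    · funext k; cases k <;> simp [St.stk, List.replicate_succ]
    · simp [add_assoc, add_comm 1 n]
    · omega

theorem runs_pushN_back (n : ℕ) (s : St) :
    Runs (pushN .back .tick n) s { s with back := s.back + n } (n + 1) := by
  induction n generalizing s with
  | zero => exact .skip
  | succ n ih =>
    refine Runs.cast (Runs.seq (.push (s' := { s with back := s.back + 1 }) ?_) (ih _)) ?_ ?_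
    · funext k; cases k <;> simp [St.stk, List.replicate_succ]
    · simp [add_assoc, add_comm 1 n]
    · omega

/-- The base address is changed. -/
def St.setBase (s : St) (r : Bool) (n : ℕ) : St :=
  bif r then { s with base := n } else { s with back := n }

theorem runs_emitBase (r : Bool) (s : St) (h : s.tmp = 0) :
    Runs (emitBase r) s
      { s with out := s.out ++ List.replicate (bif r then s.base else s.back) .tick }
      (5 * (bif r then s.base else s.back) + 2) := by
  -- A unary number can only be read by destroying it. It is moved to `tmp` while being copied to
  -- the output (`3 * n + 1` steps), then moved back (`2 * n + 1` steps).
  have h1 (n : ℕ) : ∀ s : St,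
      Runs (.loop (baseStk r) fun _ => .seq (.push .tmp .tick) (.push .out .tick)) (s.setBase r n)
        (St.setBase { s with tmp := s.tmp + n, out := s.out ++ List.replicate n .tick } r 0)
        (3 * n + 1) := by
    induction n with
    | zero =>
      exact fun s => Runs.cast (.loop_nil (by cases r <;> rfl)) (by simp) le_rfl
    | succ n ih =>
      intro s
      refine Runs.cast (Runs.loop_cons (x := .tick) (xs := List.replicate n .tick)
        (s₂ := s.setBase r n) (s₃ := St.setBase { s with tmp := s.tmp + 1, out := s.out ++ [.tick] }
          r n) ?_ ?_ (Runs.seq (s₂ := St.setBase { s with tmp := s.tmp + 1 } r n)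
            (.push ?_) (.push ?_)) (ih _)) ?_ ?_
      · cases r <;> rfl
      · cases r <;> funext k <;> cases k <;> simp [St.stk, St.setBase, baseStk]
      · cases r <;> funext k <;> cases k <;> simp [St.stk, St.setBase, List.replicate_succ]
      · cases r <;> funext k <;> cases k <;> simp [St.stk, St.setBase]
      · simp [List.replicate_succ, add_assoc, add_comm 1 n]
      · omega
  have h2 (n : ℕ) : ∀ (s : St) (m : ℕ),
      Runs (.loop .tmp fun _ => .push (baseStk r) .tick) (St.setBase { s with tmp := n } r m)
        (St.setBase { s with tmp := 0 } r (m + n)) (2 * n + 1) := by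
    induction n with
    | zero => exact fun s m => .loop_nil (by cases r <;> rfl)
    | succ n ih =>
      intro s m
      refine Runs.cast (Runs.loop_cons (x := .tick) (xs := List.replicate n .tick)
        (s₂ := St.setBase { s with tmp := n } r m)
        (s₃ := St.setBase { s with tmp := n } r (m + 1)) ?_ ?_ (.push ?_) (ih s _)) ?_ ?_
      · cases r <;> rfl
      · cases r <;> funext k <;> cases k <;> simp [St.stk, St.setBase]
      · cases r <;> funext k <;> cases k <;>
          simp [St.stk, St.setBase, baseStk, List.replicate_succ]
      · simp [add_assoc, add_comm 1 n]
      · omega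
  set v := bif r then s.base else s.back with hv
  set s' : St := { s with out := s.out ++ List.replicate v .tick }
  have hs : s.setBase r v = s := by cases r <;> rfl
  have h3 := (Runs.cast (h1 v s) (s' := St.setBase { s' with tmp := v } r 0)
    (by simp [h, s']) le_rfl).seq (h2 v s' 0)
  rw [hs] at h3
  refine h3.cast ?_ (by omega)
  cases r <;> simp [St.setBase, h, hv, s']

/-- The word of a list of marked atoms. -/
def atomsWord (tag : Symbol) (l : List ℕ) : List Symbol :=
  l.flatMap fun a => List.replicate a .tick ++ [tag]

/-- The constant `W` depends on the list alone. As only finitely many templates exist, one constant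
will serve for all blocks. -/
theorem runs_emitAtoms (tag : Symbol) (l : List (Bool × ℕ)) : ∃ W, ∀ (s : St) (X : ℕ), s.tmp = 0 →
    s.base ≤ X → s.back ≤ X → Runs (emitAtoms tag l) s
      { s with out := s.out ++ atomsWord tag (l.map (addr s.base s.back)) } (W * (X + 1)) := by
  induction l with
  | nil =>
    exact ⟨1, fun s X _ _ _ => Runs.cast .skip (by simp [atomsWord]) (by omega)⟩
  | cons x l ih =>
    obtain ⟨W, hW⟩ := ih
    refine ⟨W + (9 + x.2), fun s X h0 h1 h2 => ?_⟩
    refine Runs.cast (Runs.seq (Runs.seq (runs_emitBase x.1 s h0) (Runs.seq (runs_pushN_out _ _ _)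
      (.push (s' :=
        { s with out := s.out ++ (List.replicate (addr s.base s.back x) .tick ++ [tag]) })
        ?_))) (hW _ X h0 h1 h2)) ?_ ?_
    · funext k
      cases k <;> simp [St.stk, addr]
    · simp [atomsWord]
    · have : (bif x.1 then s.base else s.back) ≤ X := by cases x.1 <;> simpa
      nlinarith [Nat.zero_le (x.2 * X)]

/-- The word of the rule of a template. -/
def templateWord (b k : ℕ) (t : Template) : List Symbol :=
  atomsWord .head (t.head.map (addr b k)) ++ atomsWord .pos (t.pos.map (addr b k)) ++
    atomsWord .neg (t.neg.map (addr b k)) ++ [.sep]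

theorem runs_emitRules (l : List Template) : ∃ W, ∀ (s : St) (X : ℕ), s.tmp = 0 →
    s.base ≤ X → s.back ≤ X → Runs (emitRules l) s
      { s with out := s.out ++ l.flatMap (templateWord s.base s.back) } (W * (X + 1)) := by
  induction l with
  | nil =>
    exact ⟨1, fun s X _ _ _ => Runs.cast .skip (by simp) (by omega)⟩
  | cons t l ih =>
    obtain ⟨W, hW⟩ := ih
    obtain ⟨W₁, hW₁⟩ := runs_emitAtoms .head t.head
    obtain ⟨W₂, hW₂⟩ := runs_emitAtoms .pos t.pos
    obtain ⟨W₃, hW₃⟩ := runs_emitAtoms .neg t.neg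
    refine ⟨W₁ + W₂ + W₃ + 1 + W, fun s X h0 h1 h2 => ?_⟩
    refine Runs.cast (Runs.seq (Runs.seq (hW₁ s X h0 h1 h2) (Runs.seq (hW₂ _ X h0 h1 h2)
      (Runs.seq (hW₃ _ X h0 h1 h2) (.push
        (s' := { s with out := s.out ++ templateWord s.base s.back t }) ?_))))
      (hW _ X h0 h1 h2)) ?_ ?_
    · funext k
      cases k <;> simp [St.stk, templateWord]
    · simp
    · nlinarith

theorem runs_emitBlock (m : Mark) : ∃ W, ∀ (s : St) (X : ℕ), s.tmp = 0 →
    s.base ≤ X → s.back ≤ X → Runs (emitBlock m) s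
      { s with
        out := s.out ++ (templates m).flatMap (templateWord s.base s.back)
        base := if m = .start then s.base else s.base + 9
        back := if m = .start ∨ m = .init then s.back else s.back + 9 } (W * (X + 1)) := by
  obtain ⟨W, hW⟩ := runs_emitRules (templates m)
  refine ⟨W + 20, fun s X h0 h1 h2 => ?_⟩
  have key : Runs (advance m) { s with
        out := s.out ++ (templates m).flatMap (templateWord s.base s.back) } { s with
        out := s.out ++ (templates m).flatMap (templateWord s.base s.back)
        base := if m = .start then s.base else s.base + 9
        back := if m = .start ∨ m = .init then s.back else s.back + 9 } 20 := by
    cases m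
    · exact Runs.skip.cast (by simp) (by omega)
    · exact (runs_pushN_base 9 _).cast (by simp) (by omega)
    all_goals exact ((runs_pushN_base 9 _).seq (runs_pushN_back 9 _)).cast (by simp) (by omega)
  exact ((hW s X h0 h1 h2).seq key).cast rfl (by nlinarith)

theorem exists_emitBlock_cost : ∃ W, ∀ (m : Mark) (s : St) (X : ℕ), s.tmp = 0 →
    s.base ≤ X → s.back ≤ X → Runs (emitBlock m) s
      { s with
        out := s.out ++ (templates m).flatMap (templateWord s.base s.back)
        base := if m = .start then s.base else s.base + 9
        back := if m = .start ∨ m = .init then s.back else s.back + 9 } (W * (X + 1)) := by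
  choose W hW using runs_emitBlock
  refine ⟨W .start + W .init + (W (.bit true) + W (.bit false)) + (W (.tag none) +
    W (.tag (some true)) + W (.tag (some false))) + W .fin, fun m s X h0 h1 h2 => ?_⟩
  refine (hW m s X h0 h1 h2).mono (Nat.mul_le_mul_right _ ?_)
  rcases m with _ | _ | (_ | _) | (_ | _ | _) | _ <;> omega

end emit

/-- The word of the first `q` blocks of the program of `ts`. -/
def blocksWord (L : ℕ) (ts : List Token) (q : ℕ) : List Symbol :=
  (ruleList (L + 1) (tokenMark L ts) q).flatMap encodeRule

/-- The state `s` when the next block to be written is the block `q`. -/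
def St.at (s : St) (L : ℕ) (ts : List Token) (q : ℕ) : St :=
  { s with out := blocksWord L ts q, base := 9 * (q - 1), back := 9 * (q - (L + 1)) }

theorem blocksWord_succ {L : ℕ} (hL : 1 ≤ L) (ts : List Token) (q : ℕ) :
    blocksWord L ts (q + 1) = blocksWord L ts q ++ (templates (tokenMark L ts q)).flatMap
      (templateWord (9 * (q - 1)) (9 * (q - (L + 1)))) := by
  have h : ruleList (L + 1) (tokenMark L ts) (q + 1) =
      ruleList (L + 1) (tokenMark L ts) q ++ blockRules (L + 1) (tokenMark L ts) q := by
    simp [ruleList, List.range_succ]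
  rw [blocksWord, h, List.flatMap_append, blocksWord, blockRules, List.flatMap_map]
  congr 1
  refine List.flatMap_congr fun t ht => ?_
  rw [Template.encodeRule_toRule (wellFormed_of_mem ht) ((layout_tokenMark hL ts).fits ht)]
  rfl

theorem tokenMark_eq_init_iff {L : ℕ} {ts : List Token} {q : ℕ} :
    tokenMark L ts q = .init ↔ 1 ≤ q ∧ q ≤ L := by
  unfold tokenMark
  split_ifs <;> simp <;> omega

/-- A block is written in a number of steps that is linear in the addresses. -/
def BlockCost (W : ℕ) : Prop := ∀ (L : ℕ) (ts : List Token) (s : St) (q X : ℕ) (m : Mark), 1 ≤ L →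
  s.tmp = 0 → 9 * q ≤ X → tokenMark L ts q = m →
    Runs (emitBlock m) (s.at L ts q) (s.at L ts (q + 1)) (W * (X + 1))

/-- The increments in `advance` reproduce the truncated base addresses: `9 * (q - 1)` is the same
for `q = 0` and `q = 1`, and `9 * (q - (L + 1))` stays `0` until the initial period is over. -/
theorem exists_blockCost : ∃ W, BlockCost W := by
  obtain ⟨W, hW⟩ := exists_emitBlock_cost
  refine ⟨W, fun L ts s q X m hL h0 hX hm => ?_⟩
  refine (hW m (s.at L ts q) X h0 (show 9 * (q - 1) ≤ X by omega)
    (show 9 * (q - (L + 1)) ≤ X by omega)).cast ?_ le_rfl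
  have h1 : m = .start ↔ q = 0 := by rw [← hm]; exact (layout_tokenMark hL ts).start_iff q
  have h2 : m = .init ↔ 1 ≤ q ∧ q ≤ L := by rw [← hm]; exact tokenMark_eq_init_iff
  simp only [St.at, blocksWord_succ hL, hm, h1, h2]
  congr 1
  · split_ifs <;> omega
  · split_ifs <;> omega

/-- Every symbol of `k` is removed. -/
def clear (k : Stk) : Cmd Stk Symbol := .loop k fun _ => .skip

/-- `lgc` is added to `lg`. -/
def restoreLg : Cmd Stk Symbol := .loop .lgc fun _ => .push .lg .tick

/-- The number `num` is halved; `flag` is the remainder. -/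
def halve : Cmd Stk Symbol :=
  .seq (.loop .num fun _ => .cases .num fun o =>
      o.elim (.push .flag .tick) fun _ => .push .tmp .tick)
    (.loop .tmp fun _ => .push .num .tick)

theorem runs_restoreLg (n : ℕ) (s : St) (hs : s.lgc = n) :
    Runs restoreLg s { s with lg := s.lg + n, lgc := 0 } (2 * n + 1) := by
  induction n generalizing s with
  | zero => exact Runs.cast (.loop_nil (by simp [St.stk, hs])) (by cases s; simp_all) le_rfl
  | succ n ih =>
    refine Runs.cast (Runs.loop_cons (x := .tick) (xs := List.replicate n .tick)
      (s₂ := { s with lgc := n }) (s₃ := { s with lgc := n, lg := s.lg + 1 }) ?_ ?_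
      (.push ?_) (ih _ rfl)) ?_ ?_
    · simp [St.stk, hs, List.replicate_succ]
    · funext k; cases k <;> simp [St.stk]
    · funext k; cases k <;> simp [St.stk, List.replicate_succ]
    · simp [add_assoc, add_comm 1 n]
    · omega

theorem runs_halve (n : ℕ) (s : St) (hs : s.num = n) (h0 : s.tmp = 0) (h1 : s.flag = 0) :
    Runs halve s { s with num := n / 2, flag := n % 2 } (3 * n + 4) := by
  -- Each round takes two ticks, one by the loop and one by `cases`, and leaves one in `tmp`. If the
  -- second is missing, the number is odd and the flag is set.
  have l1 (n : ℕ) : ∀ s : St, s.num = n → s.flag = 0 →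
      Runs (.loop .num fun _ => .cases .num fun o =>
        o.elim (.push .flag .tick) fun _ => .push .tmp .tick) s
        { s with num := 0, tmp := s.tmp + n / 2, flag := n % 2 } (2 * n + 2) := by
    induction n using Nat.strong_induction_on with
    | _ n ih =>
      intro s hs h1
      match n, ih, hs with
      | 0, _, hs =>
        exact Runs.cast (.loop_nil (by simp [St.stk, hs])) (by cases s; simp_all) (by omega)
      | 1, _, hs =>
        refine Runs.cast (Runs.loop_cons (x := .tick) (xs := [])
          (s₂ := { s with num := 0 }) (s₃ := { s with num := 0, flag := 1 }) ?_ ?_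
          (Runs.cases (o := none) (s₂ := { s with num := 0 }) ?_ ?_ (.push ?_)) (.loop_nil ?_))
          ?_ ?_
        · simp [St.stk, hs]
        · funext k; cases k <;> simp [St.stk]
        · simp [St.stk]
        · funext k; cases k <;> simp [St.stk]
        · funext k; cases k <;> simp [St.stk, h1]
        · simp [St.stk]
        · simp
        · omega
      | n + 2, ih, hs =>
        refine Runs.cast (Runs.loop_cons (x := .tick) (xs := List.replicate (n + 1) .tick)
          (s₂ := { s with num := n + 1 }) (s₃ := { s with num := n, tmp := s.tmp + 1 }) ?_ ?_
          (Runs.cases (o := some .tick) (s₂ := { s with num := n }) ?_ ?_ (.push ?_))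
          (ih n (by omega) _ rfl h1)) ?_ ?_
        · simp [St.stk, hs, List.replicate_succ]
        · funext k; cases k <;> simp [St.stk]
        · simp [St.stk, List.replicate_succ]
        · funext k; cases k <;> simp [St.stk, List.replicate_succ]
        · funext k; cases k <;> simp [St.stk, List.replicate_succ]
        · simp only [St.mk.injEq, true_and, and_true]
          omega
        · omega
  have l2 (n : ℕ) : ∀ s : St, s.tmp = n →
      Runs (.loop .tmp fun _ => .push .num .tick) s { s with num := s.num + n, tmp := 0 }
        (2 * n + 1) := by
    induction n with
    | zero =>
      exact fun s hs => Runs.cast (.loop_nil (by simp [St.stk, hs])) (by cases s; simp_all) le_rfl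
    | succ n ih =>
      intro s hs
      refine Runs.cast (Runs.loop_cons (x := .tick) (xs := List.replicate n .tick)
        (s₂ := { s with tmp := n }) (s₃ := { s with num := s.num + 1, tmp := n }) ?_ ?_
        (.push ?_) (ih _ rfl)) ?_ ?_
      · simp [St.stk, hs, List.replicate_succ]
      · funext k; cases k <;> simp [St.stk]
      · funext k; cases k <;> simp [St.stk, List.replicate_succ]
      · simp [add_assoc, add_comm 1 n]
      · omega
  refine Runs.cast ((l1 n s hs h1).seq (l2 _ _ rfl)) ?_ ?_
  · simp [h0]
  · simp only [h0]
    omega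

theorem runs_clear_lg (n : ℕ) (s : St) (hs : s.lg = n) :
    Runs (clear .lg) s { s with lg := 0 } (2 * n + 1) := by
  induction n generalizing s with
  | zero => exact Runs.cast (.loop_nil (by simp [St.stk, hs])) (by cases s; simp_all) le_rfl
  | succ n ih =>
    refine Runs.cast (Runs.loop_cons (x := .tick) (xs := List.replicate n .tick)
      (s₂ := { s with lg := n }) ?_ ?_ .skip (ih { s with lg := n } rfl)) rfl (by omega)
    · simp [St.stk, hs, List.replicate_succ]
    · funext k; cases k <;> simp [St.stk]

theorem runs_clear_base (n : ℕ) (s : St) (hs : s.base = n) :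
    Runs (clear .base) s { s with base := 0 } (2 * n + 1) := by
  induction n generalizing s with
  | zero => exact Runs.cast (.loop_nil (by simp [St.stk, hs])) (by cases s; simp_all) le_rfl
  | succ n ih =>
    refine Runs.cast (Runs.loop_cons (x := .tick) (xs := List.replicate n .tick)
      (s₂ := { s with base := n }) ?_ ?_ .skip (ih { s with base := n } rfl)) rfl (by omega)
    · simp [St.stk, hs, List.replicate_succ]
    · funext k; cases k <;> simp [St.stk]

theorem runs_clear_back (n : ℕ) (s : St) (hs : s.back = n) :
    Runs (clear .back) s { s with back := 0 } (2 * n + 1) := by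
  induction n generalizing s with
  | zero => exact Runs.cast (.loop_nil (by simp [St.stk, hs])) (by cases s; simp_all) le_rfl
  | succ n ih =>
    refine Runs.cast (Runs.loop_cons (x := .tick) (xs := List.replicate n .tick)
      (s₂ := { s with back := n }) ?_ ?_ .skip (ih { s with back := n } rfl)) rfl (by omega)
    · simp [St.stk, hs, List.replicate_succ]
    · funext k; cases k <;> simp [St.stk]

/-! #### The length of the bit strings -/

/-- The length of the input is written to `num`. -/
def countInput : Cmd Stk Symbol :=
  .seq (.loop .inp fun x => .seq (.push .aux x) (.push .num .tick))
    (.loop .aux fun x => .push .inp x)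

/-- The size of `num` is added to `lg`. -/
def computeLg : Cmd Stk Symbol :=
  .loop .num fun _ => .seq (.push .num .tick) <| .seq halve <|
    .seq (.cases .flag fun _ => .skip) (.push .lg .tick)

theorem runs_countInput (w : List Symbol) (s : St) (hs : s.inp = w) (ha : s.aux = []) :
    Runs countInput s { s with num := s.num + w.length } (5 * w.length + 2) := by
  have l1 (w : List Symbol) : ∀ s : St, s.inp = w →
      Runs (.loop .inp fun x => .seq (.push .aux x) (.push .num .tick)) s
        { s with inp := [], aux := w.reverse ++ s.aux, num := s.num + w.length }
        (3 * w.length + 1) := by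
    induction w with
    | nil => exact fun s hs => Runs.cast (.loop_nil hs) (by cases s; simp_all) le_rfl
    | cons x w ih =>
      intro s hs
      refine Runs.cast (Runs.loop_cons (x := x) (xs := w) (s₂ := { s with inp := w })
        (s₃ := { s with inp := w, aux := x :: s.aux, num := s.num + 1 }) hs ?_
        (Runs.seq (s₂ := { s with inp := w, aux := x :: s.aux }) (.push ?_) (.push ?_))
        (ih _ rfl)) ?_ ?_
      · funext k; cases k <;> simp [St.stk]
      · funext k; cases k <;> simp [St.stk]
      · funext k; cases k <;> simp [St.stk, List.replicate_succ]
      · simp only [List.reverse_cons, List.append_assoc, List.singleton_append, List.length_cons,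
          St.mk.injEq, true_and, and_true]
        omega
      · simp only [List.length_cons]; omega
  have l2 (w : List Symbol) : ∀ s : St, s.aux = w →
      Runs (.loop .aux fun x => .push .inp x) s { s with aux := [], inp := w.reverse ++ s.inp }
        (2 * w.length + 1) := by
    induction w with
    | nil => exact fun s hs => Runs.cast (.loop_nil hs) (by cases s; simp_all) le_rfl
    | cons x w ih =>
      intro s hs
      refine Runs.cast (Runs.loop_cons (x := x) (xs := w) (s₂ := { s with aux := w })
        (s₃ := { s with aux := w, inp := x :: s.inp }) hs ?_ (.push ?_) (ih _ rfl)) ?_ ?_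
      · funext k; cases k <;> simp [St.stk]
      · funext k; cases k <;> simp [St.stk]
      · simp
      · simp only [List.length_cons]; omega
  refine Runs.cast ((l1 w s hs).seq (l2 _ _ rfl)) ?_ ?_
  · simp [ha, hs]
  · simp [ha]
    omega

theorem size_succ (n : ℕ) : (n + 1).size = ((n + 1) / 2).size + 1 := by
  have h := Nat.size_bit (b := (n + 1).bodd) (n := (n + 1).div2)
  rw [Nat.bit_bodd_div2, Nat.div2_val] at h
  exact h (Nat.succ_ne_zero n)

/-- The loop test removes a tick, which is put back before halving. A positive number loses one
binary digit per round, and `B` bounds the cost of every round. -/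
theorem runs_computeLg (n B : ℕ) (hB : n ≤ B) : ∀ s : St, s.num = n → s.tmp = 0 → s.flag = 0 →
    Runs computeLg s { s with num := 0, lg := s.lg + n.size } ((3 * B + 10) * n.size + 1) := by
  induction n using Nat.strong_induction_on with
  | _ n ih =>
    intro s hs h0 h1
    rcases n with _ | n
    · exact Runs.cast (.loop_nil (by simp [St.stk, hs])) (by cases s; simp_all) (by simp)
    · have hcases (s : St) (h : s.flag < 2) :
          Runs (.cases .flag fun _ => .skip) s { s with flag := 0 } 2 := by
        refine Runs.cases rfl ?_ .skip
        have : s.flag = 0 ∨ s.flag = 1 := by omega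
        rcases this with h | h <;> funext k <;> cases k <;> simp [St.stk, h]
      have hsize := size_succ n
      refine Runs.cast (Runs.loop_cons (x := .tick) (xs := List.replicate n .tick)
        (s₂ := { s with num := n }) (s₃ := { s with num := (n + 1) / 2, lg := s.lg + 1, flag := 0 })
        ?_ ?_ (Runs.seq (s₂ := s) (.push ?_) (Runs.seq (runs_halve (n + 1) s hs h0 h1)
          (Runs.seq (hcases _ ?_) (.push ?_))))
        (ih ((n + 1) / 2) (by omega) (by omega) _ rfl h0 rfl))
        ?_ ?_
      · simp [St.stk, hs, List.replicate_succ]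
      · funext k; cases k <;> simp [St.stk]
      · funext k; cases k <;> simp [St.stk, hs, List.replicate_succ]
      · exact Nat.mod_lt _ (by norm_num)
      · funext k; cases k <;> simp [St.stk, List.replicate_succ]
      · simp only [h1, hsize, St.mk.injEq, true_and, and_true]
        omega
      · have : (3 * B + 10) * (((n + 1) / 2).size + 1) =
            (3 * B + 10) * ((n + 1) / 2).size + (3 * B + 10) := by ring
        rw [hsize, this]
        omega


/-! #### The loops -/

/-- The blocks of the bits of the number `num` are written; `lg` is moved to `lgc`. -/
def bitsLoop : Cmd Stk Symbol :=
  .loop .lg fun _ => .seq (.push .lgc .tick) <| .seq halve <|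
    .cases .flag fun o => emitBlock (.bit o.isSome)

/-- The blocks that choose the index are written; `lg` is moved to `lgc`. -/
def initLoop : Cmd Stk Symbol :=
  .loop .lg fun _ => .seq (.push .lgc .tick) (emitBlock .init)

/-- The blocks of a token with the variable `num` are written. -/
def writeToken (o : Option Bool) : Cmd Stk Symbol :=
  .seq bitsLoop (.seq restoreLg (emitBlock (.tag o)))

/-- The blocks of all tokens are written. -/
def mainLoop : Cmd Stk Symbol :=
  .loop .inp fun
    | .tick => .push .num .tick
    | .pos => writeToken (some true)
    | .neg => writeToken (some false)
    | _ => writeToken none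

/-- The program of a formula is written. -/
def writeProgram : Cmd Stk Symbol :=
  .seq (.push .lg .tick) <| .seq countInput <| .seq computeLg <| .seq (emitBlock .start) <|
    .seq initLoop <| .seq restoreLg <| .seq mainLoop <| .seq (emitBlock .fin) <|
      .seq (clear .lg) <| .seq (clear .base) (clear .back)

/-- The symbol at the end of a token. -/
def tokenSymbol : Option Bool → Symbol
  | some true => .pos
  | some false => .neg
  | none => .sep

/-- The word of a token. -/
def tokenWord (t : Token) : List Symbol := List.replicate t.1 .tick ++ [tokenSymbol t.2]

theorem encodeClause_eq (C : Clause) : encodeClause C = (clauseTokens C).flatMap tokenWord := by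
  simp [encodeClause, clauseTokens, encodeMarked, tokenWord, tokenSymbol, List.flatMap_map]

section loops
variable {W L : ℕ} {ts : List Token}

/-- The index is shifted by one since block `0`, which also chooses a bit, is written separately.
`lg` is both the loop counter and a value needed later, hence its copy in `lgc`. -/
theorem runs_initLoop (hW : BlockCost W) (hL : 1 ≤ L) {X : ℕ} (hX : 9 * numBlocks L ts ≤ X)
    (i : ℕ) : ∀ (j : ℕ) (s : St), j + i = L → s.tmp = 0 → s.lg = i →
    Runs initLoop (s.at L ts (j + 1)) (({ s with lg := 0, lgc := s.lgc + i } : St).at L ts (L + 1))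
      (i * (W * (X + 1) + 2) + 1) := by
  induction i with
  | zero =>
    rintro j s rfl h0 hi
    exact Runs.cast (.loop_nil (by simp [St.stk, St.at, hi])) (by cases s; simp_all) (by omega)
  | succ i ih =>
    intro j s hj h0 hi
    refine Runs.cast (Runs.loop_cons (x := .tick) (xs := List.replicate i .tick)
      (s₂ := ({ s with lg := i } : St).at L ts (j + 1)) ?_ ?_
      (Runs.seq (s₂ := ({ s with lg := i, lgc := s.lgc + 1 } : St).at L ts (j + 1)) (.push ?_)
        (hW L ts _ (j + 1) X .init hL h0 ?_ ?_))
      (ih (j + 1) ({ s with lg := i, lgc := s.lgc + 1 } : St) (by omega) h0 rfl)) ?_ ?_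
    · simp [St.stk, St.at, hi, List.replicate_succ]
    · funext k; cases k <;> simp [St.stk, St.at]
    · funext k; cases k <;> simp [St.stk, St.at, List.replicate_succ]
    · have := TokenModel.init_lt (L := L) (ts := ts) (q := j + 1) (by omega)
      omega
    · exact tokenMark_init (by omega) (by omega)
    · simp [add_assoc, add_comm 1 i]
    · rw [add_mul]
      omega

/-- The invariant is that `num` holds the variable divided by `2 ^ j`, whose parity is the bit `j`
that the next block needs. -/
theorem runs_bitsLoop (hW : BlockCost W) (hL : 1 ≤ L) {X B k : ℕ} (hX : 9 * numBlocks L ts ≤ X)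
    (hk : k < ts.length) (hB : (ts.getD k (0, none)).1 ≤ B) (i : ℕ) :
    ∀ (j : ℕ) (s : St), j + i = L → s.tmp = 0 → s.flag = 0 → s.lg = i →
      s.num = (ts.getD k (0, none)).1 / 2 ^ j →
    Runs bitsLoop (s.at L ts ((L + 1) * (k + 1) + j))
      (({ s with lg := 0, lgc := s.lgc + i, num := (ts.getD k (0, none)).1 / 2 ^ L } : St).at L ts
        ((L + 1) * (k + 1) + L))
      (i * (W * (X + 1) + (3 * B + 7)) + 1) := by
  induction i with
  | zero =>
    rintro j s rfl h0 h1 hi hn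
    exact Runs.cast (.loop_nil (by simp [St.stk, St.at, hi])) (by cases s; simp_all) (by omega)
  | succ i ih =>
    intro j s hj h0 h1 hi hn
    set a := (ts.getD k (0, none)).1
    have hle : a / 2 ^ j ≤ B := (Nat.div_le_self _ _).trans hB
    have hmark : tokenMark L ts ((L + 1) * (k + 1) + j) = .bit (a.testBit j) :=
      tokenMark_bit hk (by omega)
    have hstep := hW L ts ({ s with lg := i, lgc := s.lgc + 1, num := a / 2 ^ (j + 1) } : St)
      ((L + 1) * (k + 1) + j) X _ hL h0
      (by have := TokenModel.bit_lt (L := L) (j := j) hk (by omega); omega) hmark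
    have hmod : a / 2 ^ j % 2 = 0 ∨ a / 2 ^ j % 2 = 1 := by omega
    have hcases : Runs (.cases .flag fun o => emitBlock (.bit o.isSome))
        (({ s with lg := i, lgc := s.lgc + 1, num := a / 2 ^ j / 2, flag := a / 2 ^ j % 2 } : St).at
          L ts ((L + 1) * (k + 1) + j))
        (({ s with lg := i, lgc := s.lgc + 1, num := a / 2 ^ (j + 1) } : St).at
          L ts ((L + 1) * (k + 1) + j + 1)) (W * (X + 1) + 1) := by
      rw [Nat.div_div_eq_div_mul, ← pow_succ]
      rcases hmod with h | h
      · refine Runs.cases (o := none) (by simp [St.stk, St.at, h]) ?_ (hstep.cast' ?_)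
        · funext k; cases k <;> simp [St.stk, St.at, h, h1]
        · simp [Nat.testBit_eq_decide_div_mod_eq, h]
      · refine Runs.cases (o := some .tick) (by simp [St.stk, St.at, h]) ?_ (hstep.cast' ?_)
        · funext k; cases k <;> simp [St.stk, St.at, h, h1]
        · simp [Nat.testBit_eq_decide_div_mod_eq, h]
    refine Runs.cast (Runs.loop_cons (x := .tick) (xs := List.replicate i .tick)
      (s₂ := ({ s with lg := i } : St).at L ts ((L + 1) * (k + 1) + j)) ?_ ?_
      (Runs.seq (s₂ := ({ s with lg := i, lgc := s.lgc + 1 } : St).at L ts ((L + 1) * (k + 1) + j))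
        (.push ?_) (Runs.seq (runs_halve (a / 2 ^ j) _ hn h0 h1) hcases))
      (ih (j + 1) ({ s with lg := i, lgc := s.lgc + 1, num := a / 2 ^ (j + 1) } : St) (by omega)
        h0 h1 rfl rfl)) ?_ ?_
    · simp [St.stk, St.at, hi, List.replicate_succ]
    · funext k; cases k <;> simp [St.stk, St.at]
    · funext k; cases k <;> simp [St.stk, St.at, List.replicate_succ]
    · simp [add_assoc, add_comm 1 i]
    · rw [add_mul]
      omega

/-- The symbols `tick` at the beginning of the input are counted. -/
theorem runs_mainLoop_ticks (a : ℕ) : ∀ (s s' : St) (u : List Symbol) (T : ℕ),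
    s.inp = List.replicate a .tick ++ u →
    Runs mainLoop { s with inp := u, num := s.num + a } s' T → Runs mainLoop s s' (2 * a + T) := by
  induction a with
  | zero =>
    intro s s' u T hs h
    have : ({ s with inp := u, num := s.num + 0 } : St) = s := by cases s; simp_all
    rw [this] at h
    exact h.mono (by omega)
  | succ a ih =>
    intro s s' u T hs h
    refine Runs.mono (Runs.loop_cons (x := .tick) (xs := List.replicate a .tick ++ u)
      (s₂ := { s with inp := List.replicate a .tick ++ u })
      (s₃ := { s with inp := List.replicate a .tick ++ u, num := s.num + 1 }) ?_ ?_ (.push ?_)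
      (ih _ s' u T rfl ?_)) (show 1 + (2 * a + T) + 1 ≤ _ by omega)
    · simp [St.stk, hs, List.replicate_succ]
    · funext k; cases k <;> simp [St.stk]
    · funext k; cases k <;> simp [St.stk, List.replicate_succ]
    · simpa [add_assoc, add_comm 1 a] using h

/-- A bound on the number of steps for a token. -/
def tokenCost (W L X B : ℕ) : ℕ :=
  L * (W * (X + 1) + (3 * B + 7)) + 1 + (2 * L + 1) + W * (X + 1)

theorem runs_writeToken (hW : BlockCost W) (hL : 1 ≤ L) {X B k : ℕ}
    (hX : 9 * numBlocks L ts ≤ X) (hk : k < ts.length) (hB : (ts.getD k (0, none)).1 ≤ B)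
    (hlt : (ts.getD k (0, none)).1 < 2 ^ L) (s : St) (h0 : s.tmp = 0) (h1 : s.flag = 0)
    (hi : s.lg = L) (hc : s.lgc = 0) (hn : s.num = (ts.getD k (0, none)).1) :
    Runs (writeToken (ts.getD k (0, none)).2) (s.at L ts ((L + 1) * (k + 1)))
      (({ s with num := 0 } : St).at L ts ((L + 1) * (k + 2))) (tokenCost W L X B) := by
  have hb := runs_bitsLoop hW hL hX hk hB L 0 s (by omega) h0 h1 hi (by simpa using hn)
  have ht := hW L ts ({ s with num := 0 } : St) ((L + 1) * (k + 1) + L) X _ hL h0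
    (by have := TokenModel.bit_lt (L := L) (j := L) hk le_rfl; omega) (tokenMark_tag hk)
  -- After `L` halvings nothing is left in `num`, so it is ready to count the ticks of the next
  -- token.
  rw [Nat.div_eq_of_lt hlt] at hb
  refine Runs.cast (Runs.seq hb
    (Runs.seq ((runs_restoreLg L _ (by simp [St.at, hc])).cast ?_ le_rfl) ht)) rfl ?_
  · simp [St.at, hi, hc]
  · simp only [tokenCost]; omega

/-- The input word is literally the concatenation of the token words, so one pass from left to right
suffices: ticks accumulate in `num` and any other symbol completes a token. -/
theorem runs_mainLoop (hW : BlockCost W) (hL : 1 ≤ L) {X B : ℕ}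
    (hX : 9 * numBlocks L ts ≤ X) (hB : ∀ t ∈ ts, t.1 ≤ B) (hBL : B < 2 ^ L)
    (rest : List Token) : ∀ (pre : List Token) (s : St), pre ++ rest = ts → s.tmp = 0 →
    s.flag = 0 → s.lg = L → s.lgc = 0 → s.num = 0 → s.inp = rest.flatMap tokenWord →
    Runs mainLoop (s.at L ts ((L + 1) * (pre.length + 1)))
      (({ s with inp := [] } : St).at L ts ((L + 1) * (ts.length + 1)))
      (rest.length * (2 * B + tokenCost W L X B + 1) + 1) := by
  induction rest with
  | nil =>
    rintro pre s rfl h0 h1 hi hc hn hs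
    exact Runs.cast (.loop_nil (by simp [St.stk, St.at, hs])) (by cases s; simp_all) (by omega)
  | cons t rest ih =>
    intro pre s hts h0 h1 hi hc hn hs
    have hk : pre.length < ts.length := by simp [← hts]
    have htk : ts.getD pre.length (0, none) = t := by simp [← hts]
    have htB : t.1 ≤ B := hB t (by simp [← hts])
    have key := runs_writeToken hW hL hX hk (htk ▸ htB) (by rw [htk]; omega)
      ({ s with inp := rest.flatMap tokenWord, num := t.1 } : St) h0 h1 hi hc
      (congrArg Prod.fst htk).symm
    rw [htk] at key
    have hrest := ih (pre ++ [t]) ({ s with inp := rest.flatMap tokenWord } : St) (by simp [hts])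
      h0 h1 hi hc hn rfl
    refine Runs.mono (runs_mainLoop_ticks t.1 _ _ (tokenSymbol t.2 :: rest.flatMap tokenWord) _ ?_
      (Runs.loop_cons (x := tokenSymbol t.2) (xs := rest.flatMap tokenWord)
        (s₂ := ({ s with inp := rest.flatMap tokenWord, num := t.1 } : St).at L ts
          ((L + 1) * (pre.length + 1))) rfl ?_ (T := tokenCost W L X B) ?_ hrest)) ?_
    · simp [St.at, hs, tokenWord]
    · funext k; cases k <;> simp [St.stk, St.at, hn]
    · have h : ({ s with inp := rest.flatMap tokenWord, num := 0 } : St) =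
        { s with inp := rest.flatMap tokenWord } := by rw [← hn]
      simp only [List.length_append, List.length_singleton]
      rw [← h]
      rcases t with ⟨a, _ | _ | _⟩ <;> exact key
    · simp only [List.length_cons, add_mul]
      omega

end loops

theorem length_le_flatMap_tokenWord (ts : List Token) :
    ts.length ≤ (ts.flatMap tokenWord).length := by
  induction ts with
  | nil => simp
  | cons t ts ih =>
    simp only [List.flatMap_cons, List.length_append, List.length_cons, tokenWord,
      List.length_replicate, List.length_nil]
    omega

theorem le_length_flatMap_tokenWord {ts : List Token} {t : Token} (h : t ∈ ts) :
    t.1 ≤ (ts.flatMap tokenWord).length := by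
  obtain ⟨l₁, l₂, rfl⟩ := List.append_of_mem h
  simp only [List.flatMap_append, List.flatMap_cons, List.length_append, tokenWord,
    List.length_replicate]
  omega

/-- The number of bits for the variables in an input of length `n`. -/
def bitLength (n : ℕ) : ℕ := n.size + 1

theorem lt_two_pow_bitLength (n : ℕ) : n < 2 ^ bitLength n :=
  (Nat.lt_size_self n).trans (Nat.pow_lt_pow_right one_lt_two (Nat.lt_succ_self _))

theorem bitLength_le (n : ℕ) : bitLength n ≤ n + 1 :=
  Nat.succ_le_succ (Nat.size_le.2 Nat.lt_two_pow_self)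

/-- A bound on the number of steps for the whole program. -/
def writeCost (W L n T Q : ℕ) : ℕ :=
  1 + (5 * n + 2) + ((3 * n + 10) * L + 1) + W * (9 * Q + 1) + (L * (W * (9 * Q + 1) + 2) + 1) +
    (2 * L + 1) + (T * (2 * n + (L * (W * (9 * Q + 1) + (3 * n + 7)) + 1 + (2 * L + 1) +
      W * (9 * Q + 1)) + 1) + 1) + W * (9 * Q + 1) + (2 * L + 1) + (18 * Q + 1) + (18 * Q + 1)

theorem runs_writeProgram {W : ℕ} (hW : BlockCost W) (ts : List Token) (w : List Symbol)
    (hw : w = ts.flatMap tokenWord) :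
    Runs writeProgram { inp := w }
      { out := blocksWord (bitLength w.length) ts (numBlocks (bitLength w.length) ts) }
      (writeCost W (bitLength w.length) w.length ts.length
        (numBlocks (bitLength w.length) ts)) := by
  set n := w.length with hn
  set L := bitLength n with hL
  set Q := numBlocks L ts with hQ
  have hL1 : 1 ≤ L := by simp [hL, bitLength]
  have hQ' : Q = (L + 1) * (ts.length + 1) + 1 := rfl
  have hB : ∀ t ∈ ts, t.1 ≤ n := fun t ht => by
    rw [hn, hw]
    exact le_length_flatMap_tokenWord ht
  -- This tick is the summand `1` in `bitLength`; it gives `1 ≤ L` and thus a period of at least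
  -- two.
  have r1 : Runs (.push .lg .tick) { inp := w } { inp := w, lg := 1 } 1 := by
    refine .push ?_
    funext k; cases k <;> simp [St.stk]
  have r2 := runs_countInput w { inp := w, lg := 1 } rfl rfl
  have r3 : Runs computeLg { inp := w, lg := 1, num := n }
      (St.at { inp := w, lg := L } L ts 0) ((3 * n + 10) * n.size + 1) := by
    refine (runs_computeLg n n le_rfl { inp := w, lg := 1, num := n } rfl rfl rfl).cast ?_ le_rfl
    simp [St.at, blocksWord, ruleList, hL, bitLength, add_comm]
  have r4 := hW L ts { inp := w, lg := L } 0 (9 * Q) .start hL1 rfl (by omega) tokenMark_zero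
  have r5 := runs_initLoop hW hL1 (X := 9 * Q) le_rfl L 0 { inp := w, lg := L } (by omega) rfl rfl
  have r6 : Runs restoreLg (St.at { inp := w, lgc := L } L ts (L + 1))
      (St.at { inp := w, lg := L } L ts ((L + 1) * (0 + 1))) (2 * L + 1) := by
    refine (runs_restoreLg L _ rfl).cast ?_ le_rfl
    simp [St.at]
  have r7 := runs_mainLoop hW hL1 (X := 9 * Q) le_rfl hB (lt_two_pow_bitLength n) ts []
    { inp := w, lg := L } rfl rfl rfl rfl rfl rfl hw
  have r8 := hW L ts { lg := L } ((L + 1) * (ts.length + 1)) (9 * Q) .fin hL1 rfl (by omega)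
    (tokenMark_fin hL1)
  -- Everything but the output must be empty before the second machine takes over.
  have r9 : Runs (.seq (clear .lg) (.seq (clear .base) (clear .back)))
      (St.at { lg := L } L ts ((L + 1) * (ts.length + 1) + 1)) { out := blocksWord L ts Q }
      (2 * L + 1 + ((18 * Q + 1) + (18 * Q + 1))) := by
    refine Runs.cast ((runs_clear_lg L _ rfl).seq ((runs_clear_base _ _ rfl).seq
      (runs_clear_back _ _ rfl))) rfl ?_
    simp only [St.at]
    omega
  have hsize : (3 * n + 10) * n.size ≤ (3 * n + 10) * L :=
    Nat.mul_le_mul_left _ (by simp [hL, bitLength])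
  refine Runs.mono (r1.seq ((r2.cast (by simp [hn]) le_rfl).seq
    (r3.seq (r4.seq ((r5.cast (by simp) le_rfl).seq (r6.seq (r7.seq (r8.seq r9)))))))) ?_
  simp only [writeCost, tokenCost]
  omega

theorem exists_writeProgram_cost : ∃ r : Polynomial ℕ, ∀ (ts : List Token) (w : List Symbol),
    w = ts.flatMap tokenWord → Runs writeProgram { inp := w }
      { out := blocksWord (bitLength w.length) ts (numBlocks (bitLength w.length) ts) }
      (r.eval w.length) := by
  obtain ⟨W, hW⟩ := exists_blockCost
  -- The cost is monotone, so `L` may be replaced by `n + 1` and the number of tokens by `n`, which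
  -- leaves a polynomial in `n`.
  have hr : ∃ r : Polynomial ℕ, ∀ n, r.eval n =
      writeCost W (n + 1) n n ((n + 1 + 1) * (n + 1) + 1) := by
    open Polynomial in
    refine ⟨1 + (5 * X + 2) + ((3 * X + 10) * (X + 1) + 1) +
      C W * (9 * ((X + 1 + 1) * (X + 1) + 1) + 1) +
      ((X + 1) * (C W * (9 * ((X + 1 + 1) * (X + 1) + 1) + 1) + 2) + 1) +
      (2 * (X + 1) + 1) + (X * (2 * X + ((X + 1) * (C W * (9 * ((X + 1 + 1) * (X + 1) + 1) + 1) +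
        (3 * X + 7)) + 1 + (2 * (X + 1) + 1) + C W * (9 * ((X + 1 + 1) * (X + 1) + 1) + 1)) + 1) +
        1) + C W * (9 * ((X + 1 + 1) * (X + 1) + 1) + 1) + (2 * (X + 1) + 1) +
      (18 * ((X + 1 + 1) * (X + 1) + 1) + 1) + (18 * ((X + 1 + 1) * (X + 1) + 1) + 1),
      fun n => ?_⟩
    simp [writeCost]
  obtain ⟨r, hr⟩ := hr
  refine ⟨r, fun ts w hw => (runs_writeProgram hW ts w hw).mono ?_⟩
  rw [hr]
  have h1 := bitLength_le w.length
  have h2 : ts.length ≤ w.length := hw ▸ length_le_flatMap_tokenWord ts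
  simp only [writeCost, numBlocks]
  gcongr


/-! ### The reduction -/

theorem DecidesWithin.mono {M : TM2ComputableAux Symbol Bool} {w : List Symbol} {A : Prop}
    {T T' : ℝ} (h : DecidesWithin M w A T) (hT : T ≤ T') : DecidesWithin M w A T' :=
  let ⟨b, m, hb, hm, h⟩ := h
  ⟨b, m, hb, hm.trans hT, h⟩

instance : Fintype Symbol :=
  ⟨⟨{.tick, .head, .pos, .neg, .sep}, by simp⟩, by rintro (_ | _) <;> simp⟩

theorem flatMap_encodeClause (l : List Clause) :
    l.flatMap encodeClause = (l.flatMap clauseTokens).flatMap tokenWord := by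
  rw [List.flatMap_assoc]
  exact List.flatMap_congr fun C _ => encodeClause_eq C

theorem le_length_of_mem_vars {F : CNF} {l : List Clause} (hl : Lists l F) {x : ℕ}
    (hx : x ∈ F.vars) : x ≤ (l.flatMap encodeClause).length := by
  obtain ⟨C, hC, hx⟩ := Finset.mem_biUnion.1 hx
  rw [flatMap_encodeClause]
  obtain ⟨o, ho⟩ : ∃ o, (x, o) ∈ clauseTokens C := by
    rcases Finset.mem_union.1 hx with h | h
    · exact ⟨some true, by simp [clauseTokens, h]⟩
    · exact ⟨some false, by simp [clauseTokens, h]⟩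
  exact le_length_flatMap_tokenWord (t := (x, o))
    (List.mem_flatMap.2 ⟨C, (hl.2 C).2 hC, ho⟩)

theorem exists_reduction (M : TM2ComputableAux Symbol Bool) :
    ∃ (M' : TM2ComputableAux Symbol Bool) (r : Polynomial ℕ), ∀ (F : CNF) (l : List Clause)
      (L : ℕ) (ts : List Token) (T : ℝ), Lists l F → ts = l.flatMap clauseTokens →
      L = bitLength (l.flatMap encodeClause).length →
      DecidesWithin M ((ruleList (L + 1) (tokenMark L ts) (numBlocks L ts)).flatMap encodeRule)
        (tokenProgram L ts).IsConsistent T →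
      DecidesWithin M' (l.flatMap encodeClause) F.IsSatisfiable
        ((r.eval (l.flatMap encodeClause).length : ℕ) + T) := by
  obtain ⟨r, hr⟩ := exists_writeProgram_cost
  -- Writing takes at most `r` steps, so the output has at most `r` symbols, and its transfer costs
  -- one step per symbol and one more.
  refine ⟨precomp writeProgram .inp .out M .tick, 2 * r + 1, ?_⟩
  rintro F l L ts T hl rfl rfl ⟨b, m, hb, hm, h⟩
  obtain ⟨t, ht, hexec⟩ := hr _ _ (flatMap_encodeClause l)
  have hlen := hexec.length_le .out
  simp only [St.stk, List.reverse_nil, List.length_nil, zero_add, List.length_reverse] at hlen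
  have h1 (u : List Symbol) : St.stk { inp := u } = Function.update (fun _ => []) .inp u := by
    funext k; cases k <;> simp [St.stk]
  have h2 (u : List Symbol) :
      St.stk { out := u } = Function.update (fun _ => []) .out u.reverse := by
    funext k; cases k <;> simp [St.stk]
  rw [h1, h2] at hexec
  refine ⟨b, _,
    hb.trans (isConsistent_tokenProgram_iff (by simp [bitLength]) hl fun x hx => ?_), ?_,
    precomp_outputs writeProgram .inp .out M .tick hexec h⟩
  -- Variables are written in unary, so none exceeds the length of the input and `L` bits are
  -- enough.
  · exact (le_length_of_mem_vars hl hx).trans_lt (lt_two_pow_bitLength _)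
  · have : t + ((blocksWord (bitLength (l.flatMap encodeClause).length) (l.flatMap clauseTokens)
        (numBlocks (bitLength (l.flatMap encodeClause).length)
          (l.flatMap clauseTokens))).length + 1) ≤
        (2 * r + 1 : Polynomial ℕ).eval (l.flatMap encodeClause).length := by
      simp only [Polynomial.eval_add, Polynomial.eval_mul, Polynomial.eval_ofNat,
        Polynomial.eval_one]
      omega
    rw [Nat.cast_add]
    exact add_le_add (by exact_mod_cast this) hm

/-! ### The length of the input -/

theorem length_encodeMarked_le {tag : Symbol} {s : Finset ℕ} {n : ℕ} (hs : ∀ a ∈ s, a < n) :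
    (encodeMarked tag s).length ≤ s.card * n := by
  rw [encodeMarked, List.length_flatMap]
  refine (List.sum_le_card_nsmul _ n ?_).trans (by simp)
  simp only [List.mem_map, Finset.mem_sort]
  rintro _ ⟨a, ha, rfl⟩
  simpa using hs a ha

theorem card_smallSubsets_le (n : ℕ) :
    ((Finset.range n).powerset.filter fun s => s.card ≤ 3).card ≤ (n + 1) ^ 3 := by
  have : ((Finset.range n).powerset.filter fun s => s.card ≤ 3) ⊆
      (Finset.range 4).biUnion fun i => (Finset.range n).powersetCard i := by
    intro s hs
    simp only [Finset.mem_filter, Finset.mem_powerset] at hs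
    simp only [Finset.mem_biUnion, Finset.mem_range, Finset.mem_powersetCard]
    exact ⟨s.card, by omega, hs.1, rfl⟩
  refine (Finset.card_le_card this).trans (Finset.card_biUnion_le.trans ?_)
  have h (i : ℕ) : ((Finset.range n).powersetCard i).card ≤ n ^ i := by
    rw [Finset.card_powersetCard, Finset.card_range]
    exact Nat.choose_le_pow n i
  refine (Finset.sum_le_sum fun i _ => h i).trans ?_
  simp only [Finset.sum_range_succ, Finset.sum_range_zero]
  ring_nf
  nlinarith

/-- A clause is determined by its positive and its negative part, each a set of at most three of the
`n` variables. -/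
theorem card_le_of_isThreeCNF {F : CNF} {n : ℕ} (h3 : F.IsThreeCNF)
    (hn : F.vars = Finset.range n) : F.card ≤ (n + 1) ^ 6 := by
  set S := (Finset.range n).powerset.filter fun s => s.card ≤ 3
  have : F.card ≤ (S ×ˢ S).card := by
    refine Finset.card_le_card_of_injOn (fun C => (C.pos, C.neg)) (fun C hC => ?_)
      fun C _ D _ h => ?_
    · have h := h3 C hC
      have hsub : C.pos ∪ C.neg ⊆ Finset.range n := hn ▸ Finset.subset_biUnion_of_mem
        (fun C : Clause => C.pos ∪ C.neg) hC
      simp only [Finset.coe_product, Set.mem_prod, Finset.mem_coe, S, Finset.mem_filter,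
        Finset.mem_powerset]
      exact ⟨⟨Finset.union_subset_left hsub, by omega⟩, Finset.union_subset_right hsub, by omega⟩
    · simp only [Prod.mk.injEq] at h
      exact Clause.ext h.1 h.2
  rw [Finset.card_product] at this
  calc F.card ≤ S.card * S.card := this
    _ ≤ (n + 1) ^ 3 * (n + 1) ^ 3 :=
      Nat.mul_le_mul (card_smallSubsets_le n) (card_smallSubsets_le n)
    _ = (n + 1) ^ 6 := by ring

theorem length_flatMap_encodeClause_le {F : CNF} {l : List Clause} {n : ℕ} (h3 : F.IsThreeCNF)
    (hn : F.vars = Finset.range n) (hl : Lists l F) :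
    (l.flatMap encodeClause).length ≤ 3 * (n + 1) ^ 7 := by
  have hc : ∀ k ∈ l.map fun C => (encodeClause C).length, k ≤ 3 * (n + 1) := by
    simp only [List.mem_map]
    rintro _ ⟨C, hC, rfl⟩
    have hC := (hl.2 C).1 hC
    have h := h3 C hC
    have hsub : C.pos ∪ C.neg ⊆ Finset.range n := hn ▸ Finset.subset_biUnion_of_mem
        (fun C : Clause => C.pos ∪ C.neg) hC
    have h1 := length_encodeMarked_le (tag := .pos) (s := C.pos) (n := n)
      fun a ha => Finset.mem_range.1 (hsub (Finset.mem_union_left _ ha))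
    have h2 := length_encodeMarked_le (tag := .neg) (s := C.neg) (n := n)
      fun a ha => Finset.mem_range.1 (hsub (Finset.mem_union_right _ ha))
    simp only [encodeClause, List.length_append, List.length_singleton]
    have h4 : (C.pos.card + C.neg.card) * n ≤ 3 * n := Nat.mul_le_mul_right _ h
    rw [add_mul] at h4
    omega
  have hlen : l.length ≤ (n + 1) ^ 6 := by
    refine le_trans (le_of_eq ?_) (card_le_of_isThreeCNF h3 hn)
    classical
    rw [← List.toFinset_card_of_nodup hl.1]
    congr 1
    ext x
    rw [List.mem_toFinset, hl.2]
  rw [List.length_flatMap]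
  refine (List.sum_le_card_nsmul _ _ hc).trans ?_
  rw [List.length_map, smul_eq_mul]
  calc l.length * (3 * (n + 1)) ≤ (n + 1) ^ 6 * (3 * (n + 1)) := Nat.mul_le_mul_right _ hlen
    _ = 3 * (n + 1) ^ 7 := by ring

/-! ### The growth of the running time -/

theorem exists_le_mul_add {f : ℕ → ℝ}
    (hf : Asymptotics.IsLittleO Filter.atTop f (fun k : ℕ => (k : ℝ))) {ε : ℝ} (hε : 0 < ε) :
    ∃ D : ℝ, ∀ k, f k ≤ ε * k + D := by
  obtain ⟨N, hN⟩ := Filter.eventually_atTop.1 (hf.bound hε)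
  -- The finitely many values below the threshold are absorbed into the constant.
  refine ⟨∑ i ∈ Finset.range N, |f i|, fun k => ?_⟩
  have h0 : 0 ≤ ∑ i ∈ Finset.range N, |f i| := Finset.sum_nonneg fun _ _ => abs_nonneg _
  have hk0 : 0 ≤ ε * (k : ℝ) := by positivity
  rcases lt_or_ge k N with hk | hk
  · have := Finset.single_le_sum (f := fun i => |f i|) (fun _ _ => abs_nonneg _)
      (Finset.mem_range.2 hk)
    have := le_abs_self (f k)
    linarith
  · have h1 := hN k hk
    rw [Real.norm_eq_abs, Real.norm_eq_abs, Nat.abs_cast] at h1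
    have := le_abs_self (f k)
    linarith

theorem two_pow_bitLength_le (n : ℕ) : 2 ^ bitLength n ≤ 4 * (n + 1) := by
  rcases n with _ | n
  · simp [bitLength]
  · have h : 2 ^ ((n + 1).size - 1) ≤ n + 1 := by
      refine Nat.lt_size.1 (Nat.sub_lt ?_ one_pos)
      exact Nat.size_pos.2 n.succ_pos
    have h1 : (n + 1).size = (n + 1).size - 1 + 1 :=
      (Nat.sub_add_cancel (Nat.size_pos.2 n.succ_pos)).symm
    rw [bitLength, h1, pow_succ, pow_succ]
    omega

/-- Since `2 ^ bitLength m` is at most `16 * (n + 1) ^ 7`, the bound on `k` is logarithmic in `n`. A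
small enough slope for `f` then gives `2 ^ f k = O(√n)`, which is at most `δ * n` plus a constant.
-/
theorem exists_two_pow_two_pow_le {f : ℕ → ℝ}
    (hf : Asymptotics.IsLittleO Filter.atTop f (fun k : ℕ => (k : ℝ))) {C : ℕ} (hC : 0 < C) {δ : ℝ}
    (hδ : 0 < δ) : ∃ N : ℕ, ∀ n m k : ℕ, m ≤ 3 * (n + 1) ^ 7 → k ≤ C * (bitLength m + 2) →
      (2 : ℝ) ^ ((2 : ℝ) ^ f k) ≤ 2 ^ (δ * n) * N := by
  have hC' : (0 : ℝ) < C := by exact_mod_cast hC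
  -- The factor `C` cancels the one in the bound on `k`, and `14 = 2 * 7` turns the seventh power
  -- into a square root.
  obtain ⟨D, hD⟩ := exists_le_mul_add hf (ε := 1 / (14 * C)) (by positivity)
  set E : ℝ := 2 ^ (1 + D) with hE
  have hE0 : 0 < E := by positivity
  obtain ⟨N, hN⟩ := exists_nat_ge ((2 : ℝ) ^ (δ + E ^ 2 / (4 * δ)))
  refine ⟨N, fun n m k hm hk => ?_⟩
  have hx0 : (0 : ℝ) < n + 1 := by positivity
  have hbits : (2 : ℝ) ^ (bitLength m : ℝ) ≤ 2 ^ (4 : ℝ) * (n + 1) ^ (7 : ℝ) := by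
    have h1 : 2 ^ bitLength m ≤ 16 * (n + 1) ^ 7 := by
      have := two_pow_bitLength_le m
      have : 1 ≤ (n + 1) ^ 7 := Nat.one_le_pow _ _ n.succ_pos
      omega
    have h2 : ((2 ^ bitLength m : ℕ) : ℝ) ≤ ((16 * (n + 1) ^ 7 : ℕ) : ℝ) := by exact_mod_cast h1
    push_cast at h2
    rw [Real.rpow_natCast]
    refine h2.trans (le_of_eq ?_)
    norm_num
  have hfk : f k ≤ (bitLength m : ℝ) * (1 / 14) + (1 / 7 + D) := by
    have h1 : (k : ℝ) ≤ C * (bitLength m + 2) := by exact_mod_cast hk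
    refine (hD k).trans ?_
    have h2 : 1 / (14 * (C : ℝ)) * k ≤ 1 / (14 * C) * (C * (bitLength m + 2)) := by gcongr
    have h3 : 1 / (14 * (C : ℝ)) * (C * (bitLength m + 2)) = (bitLength m + 2) / 14 := by
      field_simp
    linarith
  have hroot : (2 : ℝ) ^ f k ≤ E * Real.sqrt (n + 1) := by
    calc (2 : ℝ) ^ f k ≤ 2 ^ ((bitLength m : ℝ) * (1 / 14) + (1 / 7 + D)) :=
          Real.rpow_le_rpow_of_exponent_le one_le_two hfk
      _ = (2 ^ (bitLength m : ℝ)) ^ (1 / 14 : ℝ) * 2 ^ (1 / 7 + D) := by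
          rw [Real.rpow_add two_pos, Real.rpow_mul two_pos.le]
      _ ≤ (2 ^ (4 : ℝ) * (n + 1) ^ (7 : ℝ)) ^ (1 / 14 : ℝ) * 2 ^ (1 / 7 + D) := by gcongr
      _ = 2 ^ (4 / 14 : ℝ) * (n + 1) ^ (1 / 2 : ℝ) * 2 ^ (1 / 7 + D) := by
          rw [Real.mul_rpow (by positivity) (by positivity), ← Real.rpow_mul two_pos.le,
            ← Real.rpow_mul hx0.le]
          norm_num
      _ = 2 ^ (3 / 7 + D) * Real.sqrt (n + 1) := by
          rw [mul_right_comm, ← Real.rpow_add two_pos, Real.sqrt_eq_rpow]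
          ring_nf
      _ ≤ E * Real.sqrt (n + 1) := by
          refine mul_le_mul_of_nonneg_right ?_ (Real.sqrt_nonneg _)
          exact Real.rpow_le_rpow_of_exponent_le one_le_two (by linarith)
  have hlin : (2 : ℝ) ^ f k ≤ δ * n + (δ + E ^ 2 / (4 * δ)) := by
    refine hroot.trans ?_
    have h1 := Real.sq_sqrt hx0.le
    -- Completing the square in `√(n + 1)`; this is the origin of the constant `E ^ 2 / (4 * δ)`.
    have h2 : δ * (n : ℝ) + (δ + E ^ 2 / (4 * δ)) - E * Real.sqrt (n + 1) =
        (2 * δ * Real.sqrt (n + 1) - E) ^ 2 / (4 * δ) := by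
      have h3 : (n : ℝ) = Real.sqrt (n + 1) ^ 2 - 1 := by linarith
      set y := Real.sqrt ((n : ℝ) + 1)
      rw [h3]
      field_simp
      ring
    have h4 : 0 ≤ (2 * δ * Real.sqrt ((n : ℝ) + 1) - E) ^ 2 / (4 * δ) := by positivity
    linarith
  calc (2 : ℝ) ^ ((2 : ℝ) ^ f k) ≤ 2 ^ (δ * n + (δ + E ^ 2 / (4 * δ))) :=
        Real.rpow_le_rpow_of_exponent_le one_le_two hlin
    _ = 2 ^ (δ * n) * 2 ^ (δ + E ^ 2 / (4 * δ)) := Real.rpow_add two_pos _ _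
    _ ≤ 2 ^ (δ * n) * N := by gcongr

theorem eval_mono (p : Polynomial ℕ) : Monotone fun n => p.eval n := by
  intro m n h
  simp only [Polynomial.eval_eq_sum_range]
  gcongr

/-- The parameter enters only through its bound on the constructed programs, so one argument serves
both graphs. -/
theorem not_consistencyDecidableInTime (hETH : ExponentialTimeHypothesis) {κ : Program ℕ → ℕ}
    {C : ℕ} (hC : 0 < C) (hκ : ∀ (L : ℕ) (ts : List Token), 1 ≤ L →
      κ (tokenProgram L ts) ≤ C * (L + 2)) : ¬ ConsistencyDecidableInTime κ := by
  rintro ⟨M, f, p, hf, hM⟩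
  obtain ⟨δ, hδ, hETH⟩ := hETH
  obtain ⟨M', r, hM'⟩ := exists_reduction M
  obtain ⟨N, hN⟩ := exists_two_pow_two_pow_le hf hC hδ
  open Polynomial in
  -- A bound on the number of atoms, `9 * numBlocks L ts`, in terms of the input length, which
  -- bounds the number of tokens and, up to one, also `L`.
  set q : ℕ[X] := 9 * ((X + 1 + 1) * (X + 1) + 1) with hq
  open Polynomial in
  refine hETH ⟨M', r.comp (3 * (X + 1) ^ 7) + Polynomial.C N * (p.comp q).comp (3 * (X + 1) ^ 7),
    fun F l n h3 hn hl => ?_⟩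
  set w := l.flatMap encodeClause with hw
  set ts := l.flatMap clauseTokens with hts
  set L := bitLength w.length with hL
  have hL1 : 1 ≤ L := by simp [hL, bitLength]
  have hlen := length_flatMap_encodeClause_le h3 hn hl
  have hlay := layout_tokenMark hL1 ts
  have hatoms : (tokenProgram L ts).atoms = Finset.range (9 * numBlocks L ts) :=
    hlay.atoms_blockProgram
  have hcard : (tokenProgram L ts).atoms.card = 9 * numBlocks L ts := by
    rw [hatoms, Finset.card_range]
  have hdec := hM' F l L ts _ hl rfl rfl
    (hM (tokenProgram L ts) _ hlay.isNormalized (by rw [hcard, hatoms]) hlay.lists_ruleList)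
  have hcardq : (tokenProgram L ts).atoms.card ≤ q.eval w.length := by
    have h1 : ts.length ≤ w.length := by
      rw [hw, flatMap_encodeClause]
      exact length_le_flatMap_tokenWord ts
    have h2 : L ≤ w.length + 1 := bitLength_le _
    rw [hcard, hq, numBlocks]
    simp only [Polynomial.eval_add, Polynomial.eval_mul, Polynomial.eval_ofNat,
      Polynomial.eval_one, Polynomial.eval_X]
    gcongr
  refine hdec.mono ?_
  set m : ℕ := 3 * (n + 1) ^ 7 with hm
  have hr : ((r.eval w.length : ℕ) : ℝ) ≤ ((r.eval m : ℕ) : ℝ) := by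
    exact_mod_cast eval_mono r hlen
  have hp : ((p.eval (tokenProgram L ts).atoms.card : ℕ) : ℝ) ≤ ((p.eval (q.eval m) : ℕ) : ℝ) := by
    exact_mod_cast eval_mono p (hcardq.trans (eval_mono q hlen))
  -- This lets the additive polynomial cost of the reduction be absorbed into the product with `2 ^
  -- (δ * n)`.
  have hone : (1 : ℝ) ≤ 2 ^ (δ * n) := Real.one_le_rpow one_le_two (by positivity)
  have heval : (r.comp (3 * (Polynomial.X + 1) ^ 7) + Polynomial.C N *
      (p.comp q).comp (3 * (Polynomial.X + 1) ^ 7)).eval n =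
        r.eval m + N * p.eval (q.eval m) := by
    simp [hm, Polynomial.eval_comp]
  rw [heval, Nat.cast_add, Nat.cast_mul, mul_add, ← mul_assoc]
  refine add_le_add (hr.trans (le_mul_of_one_le_left (Nat.cast_nonneg _) hone)) ?_
  exact mul_le_mul (hN n w.length _ hlen (hκ L ts hL1)) hp (Nat.cast_nonneg _) (by positivity)

end DisjASP

theorem mainTheorem6 (hETH : DisjASP.ExponentialTimeHypothesis) :
    (¬ DisjASP.ConsistencyDecidableInTime fun P => DisjASP.bandwidth P.primalGraph) ∧
      ¬ DisjASP.ConsistencyDecidableInTime fun P => DisjASP.bandwidth P.incidenceGraph :=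
  -- The period is `L + 1`, so the bounds `9 * (p + 1)` and `24 * (p + 1)` become `C * (L + 2)`.
  ⟨DisjASP.not_consistencyDecidableInTime hETH (C := 9) (by norm_num) fun _ ts hL =>
      (DisjASP.layout_tokenMark hL ts).bandwidth_primalGraph_le,
    DisjASP.not_consistencyDecidableInTime hETH (C := 24) (by norm_num) fun _ ts hL =>
      (DisjASP.layout_tokenMark hL ts).bandwidth_incidenceGraph_le⟩
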